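/- Let $n\ge 2$ and let $(X_i,Y_i)$, $i=1,\dots,n$, be $n$ pairs of symplectic bosons, that is, fields on a complex vector space with $$X_i(z)Y_j(0)\sim \frac{\delta_{ij}}{z},\qquad X_i(z)X_j(0)\sim 0,\qquad Y_i(z)Y_j(0)\sim 0 .$$ For fields $A,B$ and $p\in\mathbb Z$ put $(AB)_p(w)=\oint_w\frac{dz}{2\pi i}(z-w)^{p-1}A(z)B(w)$ (so $(AB)_0$ is the normal ordered product), and let products of several fields be nested to the right, $ABC=(A(BC)_0)_0$. Let $\mathcal A_i=-(X_iY_i)_0$, and for a field $\mathcal O$ let $$\hat{\mathcal A}_i\mathcal O=(\mathcal A_i\mathcal O)_0,\qquad \mathcal D_i\mathcal O=(\mathcal A_i\mathcal O)_0+\bigl(X_i(Y_i\mathcal O)_0\bigr)_0,\qquad D_i=\mathcal D_i+\hat{\mathcal A}_i .$$ Put $\mathcal Y=Y_1Y_2\cdots Y_n$ and, for $I\subset\{1,\dots,n\}$, $\mathcal Y_I=\prod_{i\in I}D_i\,\mathcal Y$ (the $D_i$ applied successively). For a finite set $L$ let $L_a$ denote the collection of the sets obtained from $L$ by removing $a$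 elements. For $I,J\subset\{1,\dots,n\}$ put $K=I\cap J$, $L=I\setminus K$, $M=J\setminus K$ and $\mathcal J_{LM,p}=\{(a,b)\in\mathbb Z^2: 0\le a\le |L|,\ 0\le b\le |M|,\ p\le a+b\}$. 1. If $I\ne J$, then for $1\le p\le |L|+|M|$ $$(\mathcal Y_I\mathcal Y_J)_p=\sum_{(a,b)\in\mathcal J_{LM,p}}\ \sum_{L'\in L_a}\ \sum_{M'\in M_b}(-1)^{b-p}\binom{a+b-1}{p-1}\bigl(\mathcal Y_{K\cup L'}\,\mathcal Y_{K\cup M'}\bigr)_{p-a-b},$$ and $(\mathcal Y_I\mathcal Y_J)_p=0$ for $p\ge |L|+|M|+1$. Consequently $$\mathcal Y_I(z)\mathcal Y_J(0)\sim\sum_{p=1}^{|L|+|M|}\frac1{z^p}\sum_{(a,b)\in\mathcal J_{LM,p}}\ \sum_{L'\in L_a}\ \sum_{M'\in M_b}\frac{(-1)^{b-p}}{(a+b-p)!}\binom{a+b-1}{p-1}\bigl((\partial^{a+b-p}\mathcal Y_{K\cup L'})\,\mathcal Y_{K\cup M'}\bigr)_0 .$$ 2. If $I=J$, then $(\mathcal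 Y_I\mathcal Y_I)_p=0$ for all $p\ge1$, and $\mathcal Y_I(z)\mathcal Y_I(0)\sim 0$. -/

import Mathlib

open scoped VertexOperator

noncomputable section

namespace BosonicVOA

/-! ### Fields on a vector space

A field on `V` is a Mathlib vertex operator `A : VertexOperator ℂ V`, i.e. a formal series
`A(z) = ∑ₘ A[[m]] z ^ (-m-1)` with `A[[m]] ∈ End V`, such that `A(z) v` is a Laurent series for
every `v`. -/

section Fields

variable {V : Type*} [AddCommGroup V] [Module ℂ V]

/-- The field with prescribed modes `A[[m]] = f m`. -/
def ofModes (f : ℤ → Module.End ℂ V) (hf : ∀ v, ∃ N : ℤ, ∀ m, N ≤ m → f m v = 0) :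
    VertexOperator ℂ V :=
  VertexOperator.of_coeff (fun k => f (-k - 1)) fun v => by
    obtain ⟨N, hN⟩ := hf v
    refine ⟨-N, fun k hk => ?_⟩
    by_contra h
    exact hk (hN _ (by omega))

@[simp]
theorem ofModes_ncoeff (f : ℤ → Module.End ℂ V) (hf : ∀ v, ∃ N : ℤ, ∀ m, N ≤ m → f m v = 0)
    (m : ℤ) : (ofModes f hf)[[m]] = f m := by
  rw [ofModes, VertexOperator.ncoeff_of_coeff]
  congr 1
  ring

/-- The modes of a field annihilate a given vector from some index on. -/
theorem exists_ncoeff_eq_zero (A : VertexOperator ℂ V) (v : V) :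
    ∃ N : ℕ, ∀ m : ℤ, (N : ℤ) ≤ m → (A[[m]]) v = 0 := by
  refine ⟨(-((HahnModule.of ℂ).symm (A v)).order).toNat, fun m hm => ?_⟩
  apply VertexOperator.ncoeff_eq_zero_of_lt_order
  omega

/-- The identity field `1(z) = id`. -/
def idField : VertexOperator ℂ V :=
  ofModes (fun m => if m = -1 then 1 else 0) fun _ => ⟨0, fun m hm => by
    rw [if_neg (by omega)]; rfl⟩

/-- The derivative `∂A(z)`: `(∂A)[[m]] = -m A[[m-1]]`. -/
def fieldDeriv (A : VertexOperator ℂ V) : VertexOperator ℂ V :=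
  ofModes (fun m => (-(m : ℂ)) • A[[m - 1]]) fun v => by
    obtain ⟨N, hN⟩ := exists_ncoeff_eq_zero A v
    exact ⟨N + 1, fun m hm => by simp [hN (m - 1) (by omega)]⟩

/-- The `j`-th term of the `m`-th mode of the product `(AB)_p` applied to `v`. -/
def opeProdTerm (p : ℤ) (A B : VertexOperator ℂ V) (m : ℤ) (v : V) (j : ℕ) : V :=
  ((-1 : ℂ) ^ j * (Ring.choose (p - 1) j : ℤ)) •
    ((A[[p - 1 - j]]) ((B[[m + j]]) v) -
      (-1 : ℂ) ^ (p - 1) • (B[[m + p - 1 - j]]) ((A[[(j : ℤ)]]) v))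

theorem opeProdTerm_finite (p : ℤ) (A B : VertexOperator ℂ V) (m : ℤ) (v : V) :
    (Function.support (opeProdTerm p A B m v)).Finite := by
  obtain ⟨M, hM⟩ := exists_ncoeff_eq_zero A v
  obtain ⟨N, hN⟩ := exists_ncoeff_eq_zero B v
  refine (Set.finite_Iio (M + N + m.natAbs)).subset fun j hj => ?_
  by_contra h
  simp only [Set.mem_Iio, not_lt] at h
  apply hj
  simp [opeProdTerm, hM j (by omega), hN (m + j) (by omega)]

/-- The product `(AB)_p(w) = ∮ dz/(2πi) (z-w)^(p-1) A(z) B(w)`, the contour encircling `w`, i.e.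
`Res_z (A(z) B(w) (z-w)^(p-1)|_{|z|>|w|} - B(w) A(z) (z-w)^(p-1)|_{|w|>|z|})`; the binomial
expansions of `(z-w)^(p-1)` in the two domains give the modes below, with finitely many
nonzero terms on each vector. `(AB)_0` is the normal ordered product. -/
def opeProd (p : ℤ) (A B : VertexOperator ℂ V) : VertexOperator ℂ V :=
  ofModes
    (fun m =>
      { toFun := fun v => ∑ᶠ j : ℕ, opeProdTerm p A B m v j
        map_add' := fun v w => by
          rw [← finsum_add_distrib (opeProdTerm_finite p A B m v) (opeProdTerm_finite p A B m w)]
          refine finsum_congr fun j => ?_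
          simp only [opeProdTerm, map_add]
          rw [← smul_add]
          congr 1
          rw [smul_add]
          exact add_sub_add_comm _ _ _ _
        map_smul' := fun c v => by
          rw [RingHom.id_apply, smul_finsum]
          refine finsum_congr fun j => ?_
          simp only [opeProdTerm, map_smul]
          rw [smul_comm c, smul_comm _ c, smul_sub c] })
    fun v => by
      obtain ⟨M, hM⟩ := exists_ncoeff_eq_zero A v
      obtain ⟨N, hN⟩ := exists_ncoeff_eq_zero B v
      choose K hK using fun j : ℕ => exists_ncoeff_eq_zero B ((A[[(j : ℤ)]]) v)
      refine ⟨N + M + p.natAbs + 1 + ∑ j ∈ Finset.range M, (K j : ℤ), fun m hm => ?_⟩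
      change ∑ᶠ j : ℕ, opeProdTerm p A B m v j = 0
      rw [← finsum_zero (α := ℕ) (M := V)]
      refine finsum_congr fun j => ?_
      have hS : (0 : ℤ) ≤ ∑ j ∈ Finset.range M, (K j : ℤ) :=
        Finset.sum_nonneg fun _ _ => by positivity
      have h2 : (B[[m + p - 1 - j]]) ((A[[(j : ℤ)]]) v) = 0 := by
        by_cases hj : j < M
        · apply hK
          have h3 : (K j : ℤ) ≤ ∑ j ∈ Finset.range M, (K j : ℤ) :=
            Finset.single_le_sum (f := fun j => (K j : ℤ)) (fun _ _ => by positivity)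
              (Finset.mem_range.2 hj)
          omega
        · rw [hM j (by omega), map_zero]
      have h1 : (B[[m + j]]) v = 0 := hN _ (by omega)
      simp [opeProdTerm, h1, h2]

/-- The operator product expansion `A(z) B(w) ∼ ∑_{p=1}^N C_p(w) / (z-w)^p`, expressed by the
equivalent commutator `[A(z), B(w)] = ∑_{p=1}^N C_p(w) ∂_w^(p-1) δ(z-w) / (p-1)!` of formal
distributions, mode by mode. -/
def HasOPE (A B : VertexOperator ℂ V) (N : ℕ) (C : ℕ → VertexOperator ℂ V) : Prop :=
  ∀ m k : ℤ, A[[m]] * B[[k]] - B[[k]] * A[[m]] =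
    ∑ p ∈ Finset.Icc 1 N, ((Ring.choose m (p - 1) : ℤ) : ℂ) • (C p)[[m + k - p + 1]]

end Fields

/-- `n` pairs of symplectic bosons `(X_i, Y_i)` acting on `V`: fields with
`X_i(z) Y_j(0) ∼ δ_ij / z`, `X_i(z) X_j(0) ∼ 0`, `Y_i(z) Y_j(0) ∼ 0`. -/
structure SymplecticBosons (n : ℕ) (V : Type*) [AddCommGroup V] [Module ℂ V] where
  X : Fin n → VertexOperator ℂ V
  Y : Fin n → VertexOperator ℂ V
  ope_XY : ∀ i j, HasOPE (X i) (Y j) 1 fun _ => if i = j then idField else 0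
  ope_XX : ∀ i j, HasOPE (X i) (X j) 0 fun _ => 0
  ope_YY : ∀ i j, HasOPE (Y i) (Y j) 0 fun _ => 0

namespace SymplecticBosons

section Operators

variable {n : ℕ} {V : Type*} [AddCommGroup V] [Module ℂ V] (S : SymplecticBosons n V)

/-- `𝒜_i = -(X_i Y_i)_0`. -/
def A (i : Fin n) : VertexOperator ℂ V := -opeProd 0 (S.X i) (S.Y i)

/-- `Â_i O = (𝒜_i O)_0`. -/
def hatA (i : Fin n) (O : VertexOperator ℂ V) : VertexOperator ℂ V := opeProd 0 (S.A i) O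

/-- `𝒟_i O = (𝒜_i O)_0 + (X_i (Y_i O)_0)_0`. -/
def partialD (i : Fin n) (O : VertexOperator ℂ V) : VertexOperator ℂ V :=
  opeProd 0 (S.A i) O + opeProd 0 (S.X i) (opeProd 0 (S.Y i) O)

/-- `D_i = 𝒟_i + Â_i`. -/
def D (i : Fin n) (O : VertexOperator ℂ V) : VertexOperator ℂ V := S.partialD i O + S.hatA i O

/-- `𝒴 = Y_1 ⋯ Y_n = (Y_1 (Y_2 (⋯ Y_n)_0)_0)_0`
(the innermost product with the identity field does nothing). -/
def calY : VertexOperator ℂ V := (List.ofFn S.Y).foldr (fun A B => opeProd 0 A B) idField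

/-- `𝒴_I = ∏_{i ∈ I} D_i 𝒴`. The operators `D_i` commute on the composites of the symplectic
bosons; they are composed here in increasing order of the index. -/
def YI (I : Finset (Fin n)) : VertexOperator ℂ V := (I.sort (· ≤ ·)).foldr S.D S.calY

end Operators

/-! ### The Fock space realization -/

section Fock

open MvPolynomial

/-- Polynomials in the creation modes `x_{i,k} = X_i[[-k-1]]` and `y_{i,k} = Y_i[[-k-1]]`. -/
abbrev Fock (n : ℕ) : Type := MvPolynomial ((Fin n × ℕ) ⊕ (Fin n × ℕ)) ℂ

def fockX {n : ℕ} (i : Fin n) (m : ℤ) : Module.End ℂ (Fock n) :=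
  if m < 0 then LinearMap.mulLeft ℂ (MvPolynomial.X (Sum.inl (i, (-m - 1).toNat)))
  else (pderiv (Sum.inr (i, m.toNat)) : Derivation ℂ (Fock n) (Fock n)).toLinearMap

def fockY {n : ℕ} (i : Fin n) (m : ℤ) : Module.End ℂ (Fock n) :=
  if m < 0 then LinearMap.mulLeft ℂ (MvPolynomial.X (Sum.inr (i, (-m - 1).toNat)))
  else -(pderiv (Sum.inl (i, m.toNat)) : Derivation ℂ (Fock n) (Fock n)).toLinearMap

theorem exists_pderiv_eq_zero {n : ℕ} (f : Fock n) :
    ∃ N : ℕ, ∀ i : Fin n, ∀ m : ℕ, N ≤ m →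
      pderiv (Sum.inl (i, m)) f = 0 ∧ pderiv (Sum.inr (i, m)) f = 0 := by
  classical
  refine ⟨∑ v ∈ f.vars, (Sum.elim Prod.snd Prod.snd v + 1), fun i m hm => ⟨?_, ?_⟩⟩ <;>
  · apply pderiv_eq_zero_of_notMem_vars
    intro h
    have := Finset.single_le_sum
      (f := fun v : (Fin n × ℕ) ⊕ (Fin n × ℕ) => Sum.elim Prod.snd Prod.snd v + 1)
      (fun _ _ => Nat.zero_le _) h
    simp only [Sum.elim_inl, Sum.elim_inr] at this
    omega

theorem pderiv_comm' {n : ℕ} (a b : (Fin n × ℕ) ⊕ (Fin n × ℕ)) (f : Fock n) :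
    pderiv a (pderiv b f) = pderiv b (pderiv a f) := by
  classical
  have h : ⁅(pderiv a : Derivation ℂ (Fock n) (Fock n)),
      (pderiv b : Derivation ℂ (Fock n) (Fock n))⁆ = 0 := by
    apply MvPolynomial.derivation_ext
    intro c
    rw [Derivation.commutator_apply]
    simp only [pderiv_X, Pi.single_apply]
    split_ifs <;> simp
  have := congrArg (fun d => d f) h
  simpa [Derivation.commutator_apply, sub_eq_zero] using this

/-- The symplectic bosons acting on their Fock space. -/
def fock (n : ℕ) : SymplecticBosons n (Fock n) where
  X i := ofModes (fockX i) fun f => by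
    obtain ⟨N, hN⟩ := exists_pderiv_eq_zero f
    refine ⟨N, fun m hm => ?_⟩
    rw [fockX, if_neg (by omega)]
    exact (hN i m.toNat (by omega)).2
  Y i := ofModes (fockY i) fun f => by
    obtain ⟨N, hN⟩ := exists_pderiv_eq_zero f
    refine ⟨N, fun m hm => ?_⟩
    rw [fockY, if_neg (by omega), LinearMap.neg_apply, neg_eq_zero]
    exact (hN i m.toNat (by omega)).1
  ope_XY i j m k := by
    classical
    apply LinearMap.ext
    intro f
    simp only [ofModes_ncoeff, Finset.Icc_self, Finset.sum_singleton, Nat.sub_self,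
      Ring.choose_zero_right, Int.cast_one, one_smul, Nat.cast_one, LinearMap.sub_apply,
      Module.End.mul_apply]
    by_cases hij : i = j
    · subst hij
      simp only [if_true, idField, ofModes_ncoeff]
      by_cases hm : m < 0 <;> by_cases hk : k < 0
      · rw [if_neg (by omega)]
        simp [fockX, fockY, hm, hk, mul_left_comm]
      · by_cases h : m + k - 1 + 1 = -1
        · have : (-m - 1).toNat = k.toNat := by omega
          rw [if_pos h]
          simp [fockX, fockY, hm, hk, this]
        · rw [if_neg h]
          simp [fockX, fockY, hm, hk, pderiv_X, Pi.single_apply]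
          omega
      · by_cases h : m + k - 1 + 1 = -1
        · have : (-k - 1).toNat = m.toNat := by omega
          rw [if_pos h]
          simp [fockX, fockY, hm, hk, this]
        · rw [if_neg h]
          simp [fockX, fockY, hm, hk, pderiv_X, Pi.single_apply]
          omega
      · rw [if_neg (by omega)]
        simp [fockX, fockY, hm, hk, pderiv_comm' (Sum.inr (i, m.toNat))]
    · have hji : ¬ j = i := fun h => hij h.symm
      rw [if_neg hij]
      by_cases hm : m < 0 <;> by_cases hk : k < 0 <;>
        simp [fockX, fockY, hm, hk, hij, hji, mul_left_comm, pderiv_X,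
          pderiv_comm' (Sum.inr (i, m.toNat))]
  ope_XX i j m k := by
    classical
    apply LinearMap.ext
    intro f
    by_cases hm : m < 0 <;> by_cases hk : k < 0 <;>
      simp [fockX, hm, hk, mul_left_comm, pderiv_X, pderiv_comm' (Sum.inr (i, m.toNat))]
  ope_YY i j m k := by
    classical
    apply LinearMap.ext
    intro f
    by_cases hm : m < 0 <;> by_cases hk : k < 0 <;>
      simp [fockY, hm, hk, mul_left_comm, pderiv_X, pderiv_comm' (Sum.inl (i, m.toNat))]

end Fock

end SymplecticBosons

/-! ### Index sets -/

/-- `L_a`: the sets obtained from `L` by removing `a` elements. -/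
def removed {n : ℕ} (L : Finset (Fin n)) (a : ℕ) : Finset (Finset (Fin n)) :=
  L.powerset.filter fun L' => L'.card + a = L.card

/-- `𝒥_{LM,p} = {(a,b) | 0 ≤ a ≤ |L|, 0 ≤ b ≤ |M|, p ≤ a + b}`. -/
def indexSet {n : ℕ} (L M : Finset (Fin n)) (p : ℕ) : Finset (ℕ × ℕ) :=
  (Finset.range (L.card + 1) ×ˢ Finset.range (M.card + 1)).filter fun ab => p ≤ ab.1 + ab.2

end BosonicVOA

end

open BosonicVOA

namespace BosonicVOA

noncomputable section

variable {V : Type*} [AddCommGroup V] [Module ℂ V]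

/-! ### Finite sums -/

/-! Call a finite sum of terms `c A(z) B(w) (z - w) ^ d` regular if its expansion for `|z| > |w|`
equals its expansion for `|w| > |z|` with the fields in the opposite order. `discrepancy` is the
difference of the two. The modes of `(AB)_p` are discrepancies with exponent `p - 1`, so regularity
is a linear relation between products.

The operator `D_i` changes only the `i`-th factor of `𝒴`, turning `Y_i` into `Z_i = -(X_i Y_i Y_i +
2 ∂Y_i)`. Hence `𝒴_I` is the product of `Z_i` for `i ∈ I` and `Y_i` for `i ∉ I`
(`YI_eq_factorProd`), and factors with different indices commute. For a single index, `Y_i(z)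
Y_i(w)`, `Z_i(z) Z_i(w)`, `Z_i(z) Y_i(w) + Y_i(z) Y_i(w) / (z - w)` and `Y_i(z) Z_i(w) - Y_i(z)
Y_i(w) / (z - w)` are regular. Regular sums in mutually commuting fields can be multiplied
(`expansion_opeProd`, `sum_smul_discrepancy_opeProd`). Multiplying over all `i`, and by `(z - w) ^
q` with `q ≥ 0`, shows that `∑_{R ⊆ I △ J} (-1)^|R ∩ J| (z - w)^(q - |R|) 𝒴_{I \ R}(z) 𝒴_{J \ R}(w)`
is regular (`sum_discrepancy_YI`).

The same holds for `I \ T`, `J \ T` with `T ⊆ I △ J`. Take these relations with exponent `q - |T|`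
for `|T| ≤ q`, weighted by `(-1)^(|T ∩ J| + |T|)`, and add them. Up to the sign `(-1)^|R ∩ J|`, the
term of `R ≠ ∅` gets the coefficient `∑_{T ⊆ R, |T| ≤ q} (-1)^|T| = (-1)^q C(|R| - 1, q)`, and that
of `∅` gets `1`. Solving for the latter gives the formula with `p = q + 1`, `a = |R ∩ I|`, `b = |R ∩
J|`. The binomial coefficient vanishes for `|R| ≤ q`, so nothing remains once `q ≥ |I △ J|`. This
locality yields the operator product expansion (`discrepancy_eq_sum`), and integration by parts
rewrites products of index `≤ 0` through derivatives. -/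

theorem finsum_int_eq_finsum_nat {M : Type*} [AddCommMonoid M] (f : ℤ → M) (hf : (Function.support f).Finite) :
    ∑ᶠ a, f a = ∑ᶠ j : ℕ, (f (-1 - j) + f j) := by
  have e1 : Function.Injective fun j : ℕ => (-1 - j : ℤ) := fun a b h => by
    simp only at h; omega
  have e2 : Function.Injective fun j : ℕ => (j : ℤ) := fun a b h => by simpa using h
  rw [finsum_add_distrib (hf.preimage e1.injOn) (hf.preimage e2.injOn),
    ← finsum_mem_range e1, ← finsum_mem_range e2, ← finsum_mem_union', ← finsum_mem_univ]
  · congr 1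
    ext a
    refine finsum_congr_Prop ?_ fun _ => rfl
    simp only [Set.mem_univ, Set.mem_union, Set.mem_range, eq_iff_iff, true_iff]
    rcases lt_or_ge a 0 with h | h
    · exact Or.inl ⟨(-1 - a).toNat, by omega⟩
    · exact Or.inr ⟨a.toNat, by omega⟩
  · rw [Set.disjoint_left]
    rintro _ ⟨a, rfl⟩ ⟨b, hb⟩
    simp only at hb
    omega
  · exact hf.inter_of_right _
  · exact hf.inter_of_right _

/-! ### Expansions of `A(z) B(w) (z - w) ^ d` -/

/-- The coefficient of `z ^ (d - j) w ^ j` in `(z - w) ^ d`, expanded for `|z| > |w|`. -/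
def binomCoeff (d : ℤ) (j : ℕ) : ℂ := (-1 : ℂ) ^ j * (Ring.choose d j : ℤ)

@[simp]
theorem binomCoeff_zero_right (d : ℤ) : binomCoeff d 0 = 1 := by simp [binomCoeff]

@[simp]
theorem binomCoeff_zero_succ (j : ℕ) : binomCoeff 0 (j + 1) = 0 := by
  simp [binomCoeff, Ring.choose_zero_succ]

theorem binomCoeff_succ_succ (d : ℤ) (j : ℕ) :
    binomCoeff (d + 1) (j + 1) = binomCoeff d (j + 1) - binomCoeff d j := by
  simp only [binomCoeff, Ring.choose_succ_succ]
  push_cast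
  ring

@[simp]
theorem binomCoeff_neg_one (j : ℕ) : binomCoeff (-1) j = 1 := by
  induction j with
  | zero => simp
  | succ j ih =>
    have := binomCoeff_succ_succ (-1) j
    rw [ih] at this
    rw [neg_add_cancel, binomCoeff_zero_succ] at this
    exact (sub_eq_zero.1 this.symm)

theorem expansion_support_finite (d : ℤ) (A B : VertexOperator ℂ V) (m l : ℤ) (v : V) :
    (Function.support fun j : ℕ => binomCoeff d j • (A[[m + d - j]]) ((B[[l + j]]) v)).Finite := by
  obtain ⟨N, hN⟩ := exists_ncoeff_eq_zero B v
  refine (Set.finite_Iio (N + l.natAbs)).subset fun j hj => ?_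
  by_contra h
  simp only [Set.mem_Iio, not_lt] at h
  exact hj (by simp [hN (l + j) (by omega)])

/-- The coefficients of `A(z) B(w) (z - w) ^ d`, the power being expanded for `|z| > |w|`. -/
def expansion (d : ℤ) (A B : VertexOperator ℂ V) (m l : ℤ) : Module.End ℂ V where
  toFun v := ∑ᶠ j : ℕ, binomCoeff d j • (A[[m + d - j]]) ((B[[l + j]]) v)
  map_add' v w := by
    rw [← finsum_add_distrib (expansion_support_finite d A B m l v)
      (expansion_support_finite d A B m l w)]
    simp
  map_smul' c v := by
    rw [RingHom.id_apply, smul_finsum]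
    simp [smul_comm c]

theorem expansion_apply (d : ℤ) (A B : VertexOperator ℂ V) (m l : ℤ) (v : V) :
    expansion d A B m l v = ∑ᶠ j : ℕ, binomCoeff d j • (A[[m + d - j]]) ((B[[l + j]]) v) := rfl

theorem expansion_eq_sum (d : ℤ) (A B : VertexOperator ℂ V) (m l : ℤ) (v : V) (N : ℕ)
    (hN : ∀ k, l + N ≤ k → (B[[k]]) v = 0) :
    expansion d A B m l v =
      ∑ j ∈ Finset.range N, binomCoeff d j • (A[[m + d - j]]) ((B[[l + j]]) v) := by
  rw [expansion_apply]
  refine finsum_eq_sum_of_support_subset _ fun j hj => ?_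
  by_contra h
  simp only [Finset.coe_range, Set.mem_Iio, not_lt] at h
  exact hj (by simp [hN (l + j) (by omega)])

theorem exists_nat_forall_ncoeff_eq_zero (B : VertexOperator ℂ V) (l : ℤ) (v : V) :
    ∃ N : ℕ, ∀ N' : ℕ, N ≤ N' → ∀ k, l + N' ≤ k → (B[[k]]) v = 0 := by
  obtain ⟨N, hN⟩ := exists_ncoeff_eq_zero B v
  exact ⟨N + l.natAbs, fun N' h k hk => hN k (by omega)⟩

@[simp]
theorem expansion_zero (A B : VertexOperator ℂ V) (m l : ℤ) :
    expansion 0 A B m l = A[[m]] * B[[l]] := by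
  ext v
  obtain ⟨N, hN⟩ := exists_nat_forall_ncoeff_eq_zero B l v
  rw [expansion_eq_sum 0 A B m l v (N + 1) (hN _ (by omega)), Finset.sum_range_succ']
  simp

/-- Multiplication by `z - w`: the indices `(m, l)` pair the distribution with `z ^ m w ^ l`, and
Pascal's rule recombines the two shifted series. -/
theorem expansion_succ (d : ℤ) (A B : VertexOperator ℂ V) (m l : ℤ) :
    expansion (d + 1) A B m l = expansion d A B (m + 1) l - expansion d A B m (l + 1) := by
  ext v
  obtain ⟨N, hN⟩ := exists_nat_forall_ncoeff_eq_zero B l v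
  rw [LinearMap.sub_apply,
    expansion_eq_sum (d + 1) A B m l v (N + 1) (hN _ (by omega)),
    expansion_eq_sum d A B (m + 1) l v (N + 1) (hN _ (by omega)),
    -- One term fewer here, so that term `j` meets term `j + 1` of the other two sums.
    expansion_eq_sum d A B m (l + 1) v N (fun k hk => hN N le_rfl k (by omega)),
    Finset.sum_range_succ', Finset.sum_range_succ']
  conv_rhs => rw [add_sub_right_comm, ← Finset.sum_sub_distrib]
  congr 1
  · refine Finset.sum_congr rfl fun j _ => ?_
    rw [binomCoeff_succ_succ, sub_smul]
    have e1 : m + (d + 1) - ((j + 1 : ℕ) : ℤ) = m + d - j := by push_cast; ring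
    have e2 : m + 1 + d - ((j + 1 : ℕ) : ℤ) = m + d - j := by push_cast; ring
    have e3 : l + ((j + 1 : ℕ) : ℤ) = l + 1 + j := by push_cast; ring
    rw [e1, e2, e3]
  · rw [binomCoeff_zero_right, binomCoeff_zero_right, add_right_comm m 1 d, add_assoc m d 1]

theorem expansion_eq_zero {B : VertexOperator ℂ V} {v : V} {N : ℤ}
    (hN : ∀ k, N ≤ k → (B[[k]]) v = 0) (d : ℤ) (A : VertexOperator ℂ V) (m l : ℤ) (hl : N ≤ l) :
    expansion d A B m l v = 0 := by
  rw [expansion_eq_sum d A B m l v 0 fun k hk => hN k (by push_cast at hk; omega)]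
  simp

/-- The difference of the expansions of `A(z) B(w) (z - w) ^ d` for `|z| > |w|` and of
`B(w) A(z) (z - w) ^ d` for `|w| > |z|`. -/
def discrepancy (d : ℤ) (A B : VertexOperator ℂ V) (m l : ℤ) : Module.End ℂ V :=
  expansion d A B m l - (-1 : ℂ) ^ d • expansion d B A l m

theorem discrepancy_swap (d : ℤ) (A B : VertexOperator ℂ V) (m l : ℤ) :
    discrepancy d A B m l = -((-1 : ℂ) ^ d • discrepancy d B A l m) := by
  rw [discrepancy, discrepancy, smul_sub, smul_smul, ← mul_zpow]
  simp

@[simp]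
theorem discrepancy_zero (A B : VertexOperator ℂ V) (m l : ℤ) :
    discrepancy 0 A B m l = A[[m]] * B[[l]] - B[[l]] * A[[m]] := by
  simp [discrepancy]

theorem discrepancy_succ (d : ℤ) (A B : VertexOperator ℂ V) (m l : ℤ) :
    discrepancy (d + 1) A B m l = discrepancy d A B (m + 1) l - discrepancy d A B m (l + 1) := by
  rw [discrepancy, discrepancy, discrepancy, expansion_succ, expansion_succ,
    zpow_add_one₀ (by norm_num)]
  module

theorem opeProd_ncoeff (p : ℤ) (A B : VertexOperator ℂ V) (m : ℤ) :
    (opeProd p A B)[[m]] = discrepancy (p - 1) A B 0 m := by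
  ext v
  rw [opeProd, ofModes_ncoeff]
  change ∑ᶠ j : ℕ, opeProdTerm p A B m v j = _
  have h2 : (Function.support fun j : ℕ => (-1 : ℂ) ^ (p - 1) •
      binomCoeff (p - 1) j • (B[[m + (p - 1) - j]]) ((A[[0 + (j : ℤ)]]) v)).Finite :=
    (expansion_support_finite (p - 1) B A m 0 v).subset (Function.support_const_smul_subset _ _)
  rw [discrepancy, LinearMap.sub_apply, LinearMap.smul_apply, expansion_apply, expansion_apply,
    smul_finsum, ← finsum_sub_distrib (expansion_support_finite (p - 1) A B 0 m v) h2]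
  refine finsum_congr fun j => ?_
  rw [opeProdTerm, smul_sub, binomCoeff, smul_comm ((-1 : ℂ) ^ (p - 1)), zero_add, zero_add,
    add_sub_assoc m p 1]

theorem opeProd_zero_ncoeff (A B : VertexOperator ℂ V) (m : ℤ) :
    (opeProd 0 A B)[[m]] = discrepancy (-1) A B 0 m := opeProd_ncoeff 0 A B m

theorem ext_ncoeff {A B : VertexOperator ℂ V} (h : ∀ m, A[[m]] = B[[m]]) : A = B := by
  apply VertexOperator.ext
  intro v
  apply (HahnModule.of ℂ).symm.injective
  ext k
  have := congrArg (fun f => f v) (h (-k - 1))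
  simp only [VertexOperator.ncoeff_apply, HVertexOperator.coeff_apply_apply] at this
  simpa using this

/-! ### Commutators with expansions -/

@[simp]
theorem expansion_zero_left (d : ℤ) (B : VertexOperator ℂ V) (m l : ℤ) :
    expansion d 0 B m l = 0 := by
  ext v
  simp [expansion_apply]

@[simp]
theorem expansion_zero_right (d : ℤ) (A : VertexOperator ℂ V) (m l : ℤ) :
    expansion d A 0 m l = 0 := by
  ext v
  simp [expansion_apply]

/-- Bracketing with a fixed endomorphism is a derivation, applied termwise. The shift `c` allows `C`
to be a mode of a field, with `c` its index. -/
theorem commutator_expansion {C : Module.End ℂ V} {A A' B B' : VertexOperator ℂ V} {c : ℤ}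
    (hA : ∀ k, C * A[[k]] - A[[k]] * C = A'[[k + c]])
    (hB : ∀ k, C * B[[k]] - B[[k]] * C = B'[[k + c]]) (d m l : ℤ) :
    C * expansion d A B m l - expansion d A B m l * C =
      expansion d A' B (m + c) l + expansion d A B' m (l + c) := by
  ext v
  obtain ⟨N₁, h₁⟩ := exists_nat_forall_ncoeff_eq_zero B l v
  obtain ⟨N₂, h₂⟩ := exists_nat_forall_ncoeff_eq_zero B l (C v)
  obtain ⟨N₃, h₃⟩ := exists_nat_forall_ncoeff_eq_zero B' (l + c) v
  simp only [LinearMap.sub_apply, LinearMap.add_apply, Module.End.mul_apply]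
  rw [expansion_eq_sum d A B m l v (N₁ + N₂ + N₃) (h₁ _ (by omega)),
    expansion_eq_sum d A B m l (C v) (N₁ + N₂ + N₃) (h₂ _ (by omega)),
    expansion_eq_sum d A' B (m + c) l v (N₁ + N₂ + N₃) (h₁ _ (by omega)),
    expansion_eq_sum d A B' m (l + c) v (N₁ + N₂ + N₃) (h₃ _ (by omega)),
    map_sum, ← Finset.sum_sub_distrib, ← Finset.sum_add_distrib]
  refine Finset.sum_congr rfl fun j _ => ?_
  have e₁ := congrArg (fun f => f ((B[[l + j]]) v)) (hA (m + d - j))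
  have e₂ := congrArg (fun f => (A[[m + d - j]]) (f v)) (hB (l + j))
  simp only [LinearMap.sub_apply, Module.End.mul_apply, map_sub] at e₁ e₂
  rw [show m + c + d - j = m + d - j + c by ring, add_right_comm l c, ← e₁, ← e₂, map_smul]
  module

theorem commutator_discrepancy {C : Module.End ℂ V} {A A' B B' : VertexOperator ℂ V} {c : ℤ}
    (hA : ∀ k, C * A[[k]] - A[[k]] * C = A'[[k + c]])
    (hB : ∀ k, C * B[[k]] - B[[k]] * C = B'[[k + c]]) (d m l : ℤ) :
    C * discrepancy d A B m l - discrepancy d A B m l * C =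
      discrepancy d A' B (m + c) l + discrepancy d A B' m (l + c) := by
  have h₁ := commutator_expansion hA hB d m l
  have h₂ := commutator_expansion hB hA d l m
  simp only [discrepancy, mul_sub, sub_mul, mul_smul_comm, smul_mul_assoc]
  rw [sub_sub_sub_comm, h₁, ← smul_sub, h₂]
  module

theorem commute_expansion {C : Module.End ℂ V} {A B : VertexOperator ℂ V}
    (hA : ∀ k, Commute C (A[[k]])) (hB : ∀ k, Commute C (B[[k]])) (d m l : ℤ) :
    Commute C (expansion d A B m l) := by
  have := commutator_expansion (C := C) (A := A) (B := B) (A' := 0) (B' := 0) (c := 0)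
    (fun k => by simp [(hA k).eq]) (fun k => by simp [(hB k).eq]) d m l
  rw [expansion_zero_left, expansion_zero_right, add_zero, sub_eq_zero] at this
  exact this

theorem commute_discrepancy {C : Module.End ℂ V} {A B : VertexOperator ℂ V}
    (hA : ∀ k, Commute C (A[[k]])) (hB : ∀ k, Commute C (B[[k]])) (d m l : ℤ) :
    Commute C (discrepancy d A B m l) :=
  (commute_expansion hA hB d m l).sub_right ((commute_expansion hB hA d l m).smul_right _)

/-- All modes of the two fields commute. -/
def CommuteModes (A B : VertexOperator ℂ V) : Prop := ∀ m l, Commute (A[[m]]) (B[[l]])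

theorem CommuteModes.symm {A B : VertexOperator ℂ V} (h : CommuteModes A B) : CommuteModes B A :=
  fun m l => (h l m).symm

theorem CommuteModes.opeProd_right {A B C : VertexOperator ℂ V} (hA : CommuteModes C A)
    (hB : CommuteModes C B) (p : ℤ) : CommuteModes C (opeProd p A B) := fun m l => by
  rw [opeProd_ncoeff]
  exact commute_discrepancy (hA m) (hB m) _ _ _

theorem CommuteModes.opeProd_left {A B C : VertexOperator ℂ V} (hA : CommuteModes A C)
    (hB : CommuteModes B C) (p : ℤ) : CommuteModes (opeProd p A B) C :=
  (hA.symm.opeProd_right hB.symm p).symm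

theorem CommuteModes.idField_right (A : VertexOperator ℂ V) : CommuteModes A idField :=
  fun m l => by
    rw [idField, ofModes_ncoeff]
    split_ifs
    exacts [Commute.one_right _, Commute.zero_right _]

theorem CommuteModes.idField_left (A : VertexOperator ℂ V) : CommuteModes idField A :=
  (CommuteModes.idField_right A).symm

theorem CommuteModes.neg_left {A B : VertexOperator ℂ V} (h : CommuteModes A B) :
    CommuteModes (-A) B := fun m l => by
  simpa using (h m l).neg_left

theorem CommuteModes.add_left {A B C : VertexOperator ℂ V} (hA : CommuteModes A C)
    (hB : CommuteModes B C) : CommuteModes (A + B) C := fun m l => by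
  simpa using (hA m l).add_left (hB m l)

/-- For natural `d` the power is a polynomial, with one expansion only. Negative exponents are
excluded: `d = -1` gives the normal ordered product. -/
theorem CommuteModes.discrepancy_eq_zero {A B : VertexOperator ℂ V} (h : CommuteModes A B)
    (d : ℕ) (m l : ℤ) : discrepancy d A B m l = 0 := by
  induction d generalizing m l with
  | zero => simp [(h m l).eq]
  | succ d ih => rw [Nat.cast_succ, discrepancy_succ, ih, ih, sub_zero]

/-! ### Normal ordered products -/

theorem exists_forall_mem_ncoeff_eq_zero {ι : Type*} (A : VertexOperator ℂ V) {s : Set ι}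
    (hs : s.Finite) (u : ι → V) : ∃ N : ℤ, ∀ i ∈ s, ∀ k, N ≤ k → (A[[k]]) (u i) = 0 := by
  choose f hf using fun i => exists_ncoeff_eq_zero A (u i)
  obtain ⟨N, hN⟩ := (hs.image fun i => (f i : ℤ)).bddAbove
  exact ⟨N, fun i hi k hk => hf i k ((hN (Set.mem_image_of_mem _ hi)).trans hk)⟩

theorem opeProd_zero_apply (A B : VertexOperator ℂ V) (m : ℤ) (v : V) :
    ((opeProd 0 A B)[[m]]) v =
      ∑ᶠ j : ℕ, ((A[[-1 - j]]) ((B[[m + j]]) v) + (B[[m - 1 - j]]) ((A[[j]]) v)) := by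
  rw [opeProd, ofModes_ncoeff]
  change ∑ᶠ j : ℕ, opeProdTerm 0 A B m v j = _
  refine finsum_congr fun j => ?_
  have := binomCoeff_neg_one j
  rw [binomCoeff] at this
  simp [opeProdTerm, this]

theorem opeProd_zero_support_finite (A B : VertexOperator ℂ V) (m : ℤ) (v : V) :
    (Function.support fun j : ℕ =>
      ((A[[-1 - j]]) ((B[[m + j]]) v) + (B[[m - 1 - j]]) ((A[[j]]) v))).Finite := by
  obtain ⟨N, hN⟩ := exists_ncoeff_eq_zero A v
  obtain ⟨M, hM⟩ := exists_ncoeff_eq_zero B v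
  refine (Set.finite_Iio (N + M + m.natAbs)).subset fun j hj => ?_
  by_contra h
  simp only [Set.mem_Iio, not_lt] at h
  exact hj (by simp [hN j (by omega), hM (m + j) (by omega)])

theorem CommuteModes.mul_support_finite {A B : VertexOperator ℂ V} (h : CommuteModes A B)
    (m : ℤ) (v : V) : (Function.support fun a : ℤ => (A[[a]]) ((B[[m - 1 - a]]) v)).Finite := by
  obtain ⟨N, hN⟩ := exists_ncoeff_eq_zero A v
  obtain ⟨M, hM⟩ := exists_ncoeff_eq_zero B v
  refine (Set.finite_Icc (m - 1 - M) N).subset fun a ha => ?_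
  by_contra hc
  rw [Set.mem_Icc, not_and_or, not_le, not_le] at hc
  rcases hc with hc | hc
  · exact ha (by simp [hM (m - 1 - a) (by omega)])
  · refine ha ?_
    change (A[[a]] * B[[m - 1 - a]]) v = 0
    rw [(h a (m - 1 - a)).eq, Module.End.mul_apply, hN a (by omega), map_zero]

/-- The normal ordered product of commuting fields is their Cauchy product. -/
theorem CommuteModes.opeProd_zero_apply {A B : VertexOperator ℂ V} (h : CommuteModes A B)
    (m : ℤ) (v : V) :
    ((opeProd 0 A B)[[m]]) v = ∑ᶠ a : ℤ, (A[[a]]) ((B[[m - 1 - a]]) v) := by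
  rw [BosonicVOA.opeProd_zero_apply, finsum_int_eq_finsum_nat _ (h.mul_support_finite m v)]
  refine finsum_congr fun j => ?_
  rw [show m - 1 - (-1 - (j : ℤ)) = m + j by ring]
  congr 1
  exact congrArg (fun f => f v) (h j (m - 1 - j)).eq.symm

theorem CommuteModes.opeProd_zero_comm {A B : VertexOperator ℂ V} (h : CommuteModes A B) :
    opeProd 0 A B = opeProd 0 B A := by
  refine ext_ncoeff fun m => LinearMap.ext fun v => ?_
  rw [h.opeProd_zero_apply, h.symm.opeProd_zero_apply,
    ← finsum_comp_equiv (Equiv.subLeft (m - 1))]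
  refine finsum_congr fun a => ?_
  rw [Equiv.subLeft_apply, sub_sub_cancel]
  exact congrArg (fun f => f v) (h _ _).eq

/-- The terms of the modes of `(A (B C)_0)_0`. -/
def nestedTerm (A B C : VertexOperator ℂ V) (m : ℤ) (v : V) (x : ℕ × ℕ) : V :=
  ((A[[-1 - x.1]]) ((B[[-1 - x.2]]) ((C[[m + x.1 + x.2]]) v)) +
    (A[[-1 - x.1]]) ((C[[m + x.1 - 1 - x.2]]) ((B[[x.2]]) v))) +
  ((B[[-1 - x.2]]) ((C[[m - 1 - x.1 + x.2]]) ((A[[x.1]]) v)) +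
    (C[[m - 1 - x.1 - 1 - x.2]]) ((B[[x.2]]) ((A[[x.1]]) v)))

theorem nestedTerm_support_finite (A B C : VertexOperator ℂ V) (m : ℤ) (v : V) :
    (Function.support (nestedTerm A B C m v)).Finite := by
  obtain ⟨a, ha⟩ := exists_ncoeff_eq_zero A v
  obtain ⟨b, hb⟩ := exists_ncoeff_eq_zero B v
  obtain ⟨c, hc⟩ := exists_ncoeff_eq_zero C v
  obtain ⟨K₁, h₁⟩ := exists_forall_mem_ncoeff_eq_zero C (Set.finite_Iio b)
    fun i : ℕ => (B[[(i : ℤ)]]) v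
  obtain ⟨K₂, h₂⟩ := exists_forall_mem_ncoeff_eq_zero C (Set.finite_Iio a)
    fun i : ℕ => (A[[(i : ℤ)]]) v
  obtain ⟨K₃, h₃⟩ := exists_forall_mem_ncoeff_eq_zero B (Set.finite_Iio a)
    fun i : ℕ => (A[[(i : ℤ)]]) v
  simp only [Set.mem_Iio] at h₁ h₂ h₃
  set T := a + b + c + K₁.natAbs + K₂.natAbs + K₃.natAbs + m.natAbs + 1 with hT
  refine ((Set.finite_Iio T).prod (Set.finite_Iio T)).subset fun ⟨j, i⟩ hx => ?_
  by_contra hji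
  simp only [Set.mem_prod, Set.mem_Iio, not_and_or, not_lt] at hji
  refine hx ?_
  simp only [nestedTerm]
  have t₂ : (C[[m + j - 1 - i]]) ((B[[(i : ℤ)]]) v) = 0 := by
    by_cases hi : i < b
    · exact h₁ i hi _ (by omega)
    · rw [hb _ (by omega), map_zero]
  have t₃ : (C[[m - 1 - j + i]]) ((A[[(j : ℤ)]]) v) = 0 := by
    by_cases hj : j < a
    · exact h₂ j hj _ (by omega)
    · rw [ha _ (by omega), map_zero]
  have t₄ : (B[[(i : ℤ)]]) ((A[[(j : ℤ)]]) v) = 0 := by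
    by_cases hj : j < a
    · exact h₃ j hj _ (by omega)
    · rw [ha _ (by omega), map_zero]
  simp [hc (m + j + i) (by omega), t₂, t₃, t₄]

theorem opeProd_opeProd_zero_apply (A B C : VertexOperator ℂ V) (m : ℤ) (v : V) :
    ((opeProd 0 A (opeProd 0 B C))[[m]]) v = ∑ᶠ x : ℕ × ℕ, nestedTerm A B C m v x := by
  rw [opeProd_zero_apply, finsum_curry _ (nestedTerm_support_finite A B C m v)]
  refine finsum_congr fun j => ?_
  have h₁ := opeProd_zero_support_finite B C (m + j) v
  have h₂ := (A[[-1 - (j : ℤ)]]).toAddMonoidHom.map_finsum h₁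
  have h₃ := h₁.subset (Function.support_comp_subset (map_zero (A[[-1 - (j : ℤ)]])) _)
  simp only [LinearMap.toAddMonoidHom_coe] at h₂
  rw [opeProd_zero_apply, opeProd_zero_apply, h₂]
  refine (finsum_add_distrib h₃
    (opeProd_zero_support_finite B C (m - 1 - j) ((A[[j]]) v))).symm.trans ?_
  refine finsum_congr fun i => ?_
  simp [nestedTerm]

/-- Left multiplications by fields whose creation modes commute and whose annihilation modes
commute can be exchanged. -/
theorem opeProd_zero_left_comm {A B : VertexOperator ℂ V}
    (hneg : ∀ m l : ℤ, m < 0 → l < 0 → Commute (A[[m]]) (B[[l]]))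
    (hpos : ∀ m l : ℤ, 0 ≤ m → 0 ≤ l → Commute (A[[m]]) (B[[l]])) (C : VertexOperator ℂ V) :
    opeProd 0 A (opeProd 0 B C) = opeProd 0 B (opeProd 0 A C) := by
  refine ext_ncoeff fun m => LinearMap.ext fun v => ?_
  have hcomm : ∀ i j : ℕ, ∀ u, (A[[-1 - (j : ℤ)]]) ((B[[-1 - (i : ℤ)]]) u) =
      (B[[-1 - (i : ℤ)]]) ((A[[-1 - (j : ℤ)]]) u) := fun i j u =>
    congrArg (fun f => f u) (hneg _ _ (by omega) (by omega)).eq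
  have hcomm' : ∀ i j : ℕ, (A[[(j : ℤ)]]) ((B[[(i : ℤ)]]) v) =
      (B[[(i : ℤ)]]) ((A[[(j : ℤ)]]) v) := fun i j =>
    congrArg (fun f => f v) (hpos _ _ (by omega) (by omega)).eq
  -- Exchanging the summation indices matches the mixed creation-annihilation terms with no
  -- commutation; `hcomm` and `hcomm'` treat the other two.
  rw [opeProd_opeProd_zero_apply, opeProd_opeProd_zero_apply,
    ← finsum_comp_equiv (Equiv.prodComm ℕ ℕ) (f := nestedTerm B A C m v)]
  refine finsum_congr fun ⟨j, i⟩ => ?_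
  simp only [nestedTerm, Equiv.prodComm_apply, Prod.swap_prod_mk, hcomm, hcomm']
  have e₁ : m + (i : ℤ) + j = m + j + i := by ring
  have e₂ : m - 1 - (i : ℤ) + j = m + j - 1 - i := by ring
  have e₃ : m + (i : ℤ) - 1 - j = m - 1 - j + i := by ring
  have e₄ : m - 1 - (i : ℤ) - 1 - j = m - 1 - j - 1 - i := by ring
  rw [e₁, e₂, e₃, e₄]
  abel

/-! ### Convolution of bilocal distributions -/

/-- A bilocal distribution `F(z, w)` with `F(z, w) v ∈ V((z))((w))` for every `v`. -/
def IsLowerTruncated (F : ℤ → ℤ → Module.End ℂ V) : Prop :=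
  ∀ v, (∃ N, ∀ m l, N ≤ l → F m l v = 0) ∧ ∀ l, ∃ N, ∀ m, N ≤ m → F m l v = 0

theorem isLowerTruncated_expansion (d : ℤ) (A B : VertexOperator ℂ V) :
    IsLowerTruncated (expansion d A B) := fun v => by
  refine ⟨?_, fun l => ?_⟩
  · obtain ⟨N, hN⟩ := exists_ncoeff_eq_zero B v
    exact ⟨N, fun m l hl => expansion_eq_zero hN d A m l hl⟩
  · obtain ⟨N, hN⟩ := exists_nat_forall_ncoeff_eq_zero B l v
    obtain ⟨K, hK⟩ := exists_forall_mem_ncoeff_eq_zero A (Set.finite_Iio N)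
      fun j : ℕ => (B[[l + j]]) v
    refine ⟨K - d + N, fun m hm => ?_⟩
    rw [expansion_eq_sum d A B m l v N (hN N le_rfl)]
    refine Finset.sum_eq_zero fun j hj => ?_
    rw [Finset.mem_range] at hj
    rw [hK j hj _ (by omega), smul_zero]

/-- The product of two bilocal distributions, coefficientwise. -/
def bilocalMul (F G : ℤ → ℤ → Module.End ℂ V) (m l : ℤ) (v : V) : V :=
  ∑ᶠ x : ℤ × ℤ, F x.1 x.2 (G (m - 1 - x.1) (l - 1 - x.2) v)

/-- Truncation in `w` leaves finitely many second indices, and for each of them truncation in `z`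
bounds the first. Commutativity lets `F` act on `v` first. -/
theorem bilocalMul_support_finite {F G : ℤ → ℤ → Module.End ℂ V} (hF : IsLowerTruncated F)
    (hG : IsLowerTruncated G) (h : ∀ a b c d, Commute (F a b) (G c d)) (m l : ℤ) (v : V) :
    (Function.support fun x : ℤ × ℤ => F x.1 x.2 (G (m - 1 - x.1) (l - 1 - x.2) v)).Finite := by
  obtain ⟨⟨N, hN⟩, hF'⟩ := hF v
  obtain ⟨⟨M, hM⟩, hG'⟩ := hG v
  choose f hf using hF'
  choose g hg using hG'
  refine ((Set.finite_Icc (l - 1 - M) N).biUnion fun b _ =>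
    (Set.finite_Icc (m - 1 - g (l - 1 - b)) (f b)).prod (Set.finite_singleton b)).subset ?_
  rintro ⟨a, b⟩ hab
  have h₁ : G (m - 1 - a) (l - 1 - b) v ≠ 0 := fun h0 => hab (by simp [h0])
  have h₂ : F a b v ≠ 0 := fun h0 => hab <| by
    change (F a b * G (m - 1 - a) (l - 1 - b)) v = 0
    rw [(h _ _ _ _).eq, Module.End.mul_apply, h0, map_zero]
  simp only [Set.mem_iUnion, Set.mem_prod, Set.mem_Icc, Set.mem_singleton_iff]
  refine ⟨b, ⟨?_, ?_⟩, ⟨?_, ?_⟩, rfl⟩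
  · by_contra hc; exact h₁ (hM _ _ (by omega))
  · by_contra hc; exact h₂ (hN _ _ (by omega))
  · by_contra hc; exact h₁ (hg _ _ (by omega))
  · by_contra hc; exact h₂ (hf _ _ (by omega))

theorem exists_forall_bilocalMul_eq_zero {F G : ℤ → ℤ → Module.End ℂ V} (hF : IsLowerTruncated F)
    (hG : IsLowerTruncated G) (h : ∀ a b c d, Commute (F a b) (G c d)) (v : V) :
    ∃ N, ∀ m l, N ≤ l → bilocalMul F G m l v = 0 := by
  obtain ⟨N, hN⟩ := (hF v).1
  obtain ⟨M, hM⟩ := (hG v).1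
  refine ⟨N + M + 1, fun m l hl => ?_⟩
  rw [bilocalMul, ← finsum_zero (α := ℤ × ℤ)]
  refine finsum_congr fun ⟨a, b⟩ => ?_
  by_cases hb : N ≤ b
  · change (F a b * G (m - 1 - a) (l - 1 - b)) v = 0
    rw [(h _ _ _ _).eq, Module.End.mul_apply, hN _ _ hb, map_zero]
  · simp [hM (m - 1 - a) (l - 1 - b) (by omega)]

theorem bilocalMul_comm {F G : ℤ → ℤ → Module.End ℂ V}
    (h : ∀ a b c d, Commute (F a b) (G c d)) (m l : ℤ) (v : V) :
    bilocalMul F G m l v = bilocalMul G F m l v := by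
  rw [bilocalMul, bilocalMul,
    ← finsum_comp_equiv ((Equiv.subLeft (m - 1)).prodCongr (Equiv.subLeft (l - 1)))]
  refine finsum_congr fun ⟨a, b⟩ => ?_
  simp only [Equiv.prodCongr_apply, Prod.map_apply, Equiv.subLeft_apply, sub_sub_cancel]
  exact congrArg (fun f => f v) (h _ _ _ _).eq

theorem bilocalMul_swap (F G : ℤ → ℤ → Module.End ℂ V) (m l : ℤ) (v : V) :
    bilocalMul (fun a b => F b a) (fun a b => G b a) m l v = bilocalMul F G l m v := by
  rw [bilocalMul, bilocalMul, ← finsum_comp_equiv (Equiv.prodComm ℤ ℤ)]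
  rfl

theorem bilocalMul_expansion_succ {F : ℤ → ℤ → Module.End ℂ V} (hF : IsLowerTruncated F)
    {d : ℤ} {A B : VertexOperator ℂ V}
    (h : ∀ a b c e d, Commute (F a b) (expansion d A B c e)) (m l : ℤ) (v : V) :
    bilocalMul F (expansion (d + 1) A B) m l v =
      bilocalMul F (expansion d A B) (m + 1) l v - bilocalMul F (expansion d A B) m (l + 1) v := by
  have hd := isLowerTruncated_expansion d A B
  have h' := fun a b c e => h a b c e d
  rw [bilocalMul, bilocalMul, bilocalMul, ← finsum_sub_distrib
    (bilocalMul_support_finite hF hd h' _ _ _) (bilocalMul_support_finite hF hd h' _ _ _)]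
  refine finsum_congr fun x => ?_
  rw [expansion_succ, LinearMap.sub_apply, map_sub]
  congr 4 <;> ring_nf

/-- A distribution annihilated by `z - w` with vanishing coefficients for large `l` is zero. -/
theorem eq_zero_of_shift_eq {E : Type*} [AddCommGroup E] {H : ℤ → ℤ → E} (hH : ∀ m l, H (m + 1) l = H m (l + 1))
    (h0 : ∃ N, ∀ m l, N ≤ l → H m l = 0) (m l : ℤ) : H m l = 0 := by
  obtain ⟨N, hN⟩ := h0
  have key : ∀ k : ℕ, ∀ m l, H m l = H (m - k) (l + k) := by
    intro k
    induction k with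
    | zero => simp
    | succ k ih =>
      intro m l
      rw [ih, ← sub_add_cancel (m - (k : ℤ)) 1, hH]
      push_cast
      congr 1 <;> ring
  rw [key (N - l).toNat, hN _ _ (by omega)]

theorem CommuteModes.commute_expansion {A B A' B' : VertexOperator ℂ V} (h₁ : CommuteModes A A')
    (h₂ : CommuteModes A B') (h₃ : CommuteModes B A') (h₄ : CommuteModes B B')
    (d e a b m l : ℤ) : Commute (expansion d A B a b) (expansion e A' B' m l) :=
  BosonicVOA.commute_expansion
    (fun k => (BosonicVOA.commute_expansion (fun k' => (h₁ k' k).symm)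
      (fun k' => (h₃ k' k).symm) d a b).symm)
    (fun k => (BosonicVOA.commute_expansion (fun k' => (h₂ k' k).symm)
      (fun k' => (h₄ k' k).symm) d a b).symm) e m l

/-! ### Multiplicativity of expansions -/

section Product

variable {A B A' B' : VertexOperator ℂ V}

/-- Going up is multiplication by `z - w`. Going down uses that this multiplication is injective on
distributions truncated in `w`, by `eq_zero_of_shift_eq`. -/
theorem expansion_opeProd_succ_iff (h₁ : CommuteModes A A') (h₂ : CommuteModes A B')
    (h₃ : CommuteModes B A') (h₄ : CommuteModes B B') (d e : ℤ) :
    (∀ m l v, expansion (d + e) (opeProd 0 A A') (opeProd 0 B B') m l v =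
      bilocalMul (expansion d A B) (expansion e A' B') m l v) ↔
    ∀ m l v, expansion (d + (e + 1)) (opeProd 0 A A') (opeProd 0 B B') m l v =
      bilocalMul (expansion d A B) (expansion (e + 1) A' B') m l v := by
  have hc := CommuteModes.commute_expansion h₁ h₂ h₃ h₄
  have hd := isLowerTruncated_expansion d A B
  have he := isLowerTruncated_expansion e A' B'
  have hs := bilocalMul_expansion_succ (F := expansion d A B) (d := e) hd
    fun a b c f d' => hc d d' a b c f
  refine ⟨fun h m l v => ?_, fun h m l v => ?_⟩
  · rw [← add_assoc, expansion_succ, LinearMap.sub_apply, h, h, hs]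
  · rw [← sub_eq_zero]
    refine eq_zero_of_shift_eq (H := fun m l =>
      expansion (d + e) (opeProd 0 A A') (opeProd 0 B B') m l v -
        bilocalMul (expansion d A B) (expansion e A' B') m l v) (fun m l => ?_) ?_ m l
    · have := h m l v
      rw [← add_assoc, expansion_succ, LinearMap.sub_apply, hs] at this
      rw [← sub_eq_zero] at this ⊢
      rw [← this]
      abel
    · obtain ⟨N, hN⟩ := exists_forall_bilocalMul_eq_zero hd he (fun a b c f => hc d e a b c f) v
      obtain ⟨M, hM⟩ := (isLowerTruncated_expansion (d + e) (opeProd 0 A A')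
        (opeProd 0 B B') v).1
      exact ⟨max N M, fun m l hl => by
        rw [hN m l (le_of_max_le_left hl), hM m l (le_of_max_le_right hl), sub_zero]⟩

/-- The factors stand in the order `A A' B B'` on one side and `A B A' B'` on the other, so
reordering uses only `h₃`. -/
theorem expansion_opeProd_zero (h₁ : CommuteModes A A') (h₂ : CommuteModes A B')
    (h₃ : CommuteModes B A') (h₄ : CommuteModes B B') (m l : ℤ) (v : V) :
    expansion (0 + 0) (opeProd 0 A A') (opeProd 0 B B') m l v =
      bilocalMul (expansion 0 A B) (expansion 0 A' B') m l v := by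
  have hc := bilocalMul_support_finite (isLowerTruncated_expansion 0 A B)
    (isLowerTruncated_expansion 0 A' B')
    (CommuteModes.commute_expansion h₁ h₂ h₃ h₄ 0 0) m l v
  have e := h₄.mul_support_finite l v
  have hm := ((opeProd 0 A A')[[m]]).toAddMonoidHom.map_finsum e
  simp only [LinearMap.toAddMonoidHom_coe] at hm
  rw [bilocalMul, add_zero, expansion_zero, Module.End.mul_apply, h₄.opeProd_zero_apply, hm,
    ← finsum_comp_equiv (Equiv.prodComm ℤ ℤ), finsum_curry _ (hc.preimage (Equiv.injective _).injOn)]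
  refine finsum_congr fun b => ?_
  rw [h₁.opeProd_zero_apply]
  refine finsum_congr fun a => ?_
  simp only [Equiv.prodComm_apply, Prod.swap_prod_mk, expansion_zero, Module.End.mul_apply]
  exact congrArg (fun f => (A[[a]]) (f ((B'[[l - 1 - b]]) v))) (h₃ _ _).eq.symm

theorem expansion_opeProd (h₁ : CommuteModes A A') (h₂ : CommuteModes A B')
    (h₃ : CommuteModes B A') (h₄ : CommuteModes B B') (d e m l : ℤ) (v : V) :
    expansion (d + e) (opeProd 0 A A') (opeProd 0 B B') m l v =
      bilocalMul (expansion d A B) (expansion e A' B') m l v := by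
  have step : ∀ {A B A' B' : VertexOperator ℂ V} (_ : CommuteModes A A') (_ : CommuteModes A B')
      (_ : CommuteModes B A') (_ : CommuteModes B B') (d e : ℤ),
      (∀ m l v, expansion (d + 0) (opeProd 0 A A') (opeProd 0 B B') m l v =
        bilocalMul (expansion d A B) (expansion 0 A' B') m l v) →
      ∀ m l v, expansion (d + e) (opeProd 0 A A') (opeProd 0 B B') m l v =
        bilocalMul (expansion d A B) (expansion e A' B') m l v := by
    intro A B A' B' h₁ h₂ h₃ h₄ d e h0
    induction e using Int.induction_on with
    | zero => exact h0
    | succ i ih => exact (expansion_opeProd_succ_iff h₁ h₂ h₃ h₄ d i).1 ih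
    | pred i ih =>
      refine (expansion_opeProd_succ_iff h₁ h₂ h₃ h₄ d (-i - 1)).2 ?_
      rwa [sub_add_cancel]
  -- The start of the induction on `e` is the case `(d, 0)`. Exchanging primed and unprimed fields
  -- turns it into `(0, d)`, which is reached from `(0, 0)`.
  refine step h₁ h₂ h₃ h₄ d e (fun m l v => ?_) m l v
  have := step h₁.symm h₃.symm h₂.symm h₄.symm 0 d
    (expansion_opeProd_zero h₁.symm h₃.symm h₂.symm h₄.symm) m l v
  rw [add_comm, h₁.opeProd_zero_comm, h₄.opeProd_zero_comm, this]
  exact bilocalMul_comm (fun a b c f =>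
    (CommuteModes.commute_expansion h₁ h₂ h₃ h₄ d 0 c f a b).symm) m l v

end Product

/-! ### Regular families -/

theorem sum_smul_bilocalMul {ι κ : Type*} (s : Finset ι) (t : Finset κ) (c : ι → ℂ) (c' : κ → ℂ)
    {F : ι → ℤ → ℤ → Module.End ℂ V} {G : κ → ℤ → ℤ → Module.End ℂ V}
    (h : ∀ i ∈ s, ∀ k ∈ t, ∀ m l v, (Function.support fun x : ℤ × ℤ =>
      F i x.1 x.2 (G k (m - 1 - x.1) (l - 1 - x.2) v)).Finite) (m l : ℤ) (v : V) :
    ∑ i ∈ s, ∑ k ∈ t, (c i * c' k) • bilocalMul (F i) (G k) m l v =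
      bilocalMul (fun a b => ∑ i ∈ s, c i • F i a b) (fun a b => ∑ k ∈ t, c' k • G k a b)
        m l v := by
  have h' : ∀ i ∈ s, ∀ k ∈ t, (Function.support fun x : ℤ × ℤ =>
      (c i * c' k) • F i x.1 x.2 (G k (m - 1 - x.1) (l - 1 - x.2) v)).Finite :=
    fun i hi k hk => (h i hi k hk m l v).subset (Function.support_const_smul_subset _ _)
  have h'' : ∀ i ∈ s, (Function.support fun x : ℤ × ℤ =>
      ∑ k ∈ t, (c i * c' k) • F i x.1 x.2 (G k (m - 1 - x.1) (l - 1 - x.2) v)).Finite :=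
    fun i hi => (t.finite_toSet.biUnion fun k hk => h' i hi k hk).subset
      (Finset.support_sum _ _)
  simp only [bilocalMul, smul_finsum]
  rw [Finset.sum_congr rfl fun i hi => sum_finsum_comm t _ (h' i hi), sum_finsum_comm s _ h'']
  refine finsum_congr fun x => ?_
  simp only [LinearMap.sum_apply, LinearMap.smul_apply, map_sum, map_smul, Finset.smul_sum,
    smul_smul, mul_comm]
  rw [Finset.sum_comm]

/-- If `∑ cᵢ Aᵢ(z) Bᵢ(w) (z - w) ^ dᵢ` and `∑ c'ₖ A'ₖ(z) B'ₖ(w) (z - w) ^ d'ₖ` do not depend on the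
domain of expansion, then neither does the product of these sums. -/
theorem sum_smul_discrepancy_opeProd {ι κ : Type*} (s : Finset ι) (t : Finset κ) (c : ι → ℂ)
    (c' : κ → ℂ) (d : ι → ℤ) (d' : κ → ℤ) (A B : ι → VertexOperator ℂ V)
    (A' B' : κ → VertexOperator ℂ V)
    (h₁ : ∀ i ∈ s, ∀ k ∈ t, CommuteModes (A i) (A' k))
    (h₂ : ∀ i ∈ s, ∀ k ∈ t, CommuteModes (A i) (B' k))
    (h₃ : ∀ i ∈ s, ∀ k ∈ t, CommuteModes (B i) (A' k))
    (h₄ : ∀ i ∈ s, ∀ k ∈ t, CommuteModes (B i) (B' k))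
    (hs : ∀ m l, ∑ i ∈ s, c i • discrepancy (d i) (A i) (B i) m l = 0)
    (ht : ∀ m l, ∑ k ∈ t, c' k • discrepancy (d' k) (A' k) (B' k) m l = 0) (m l : ℤ) :
    ∑ i ∈ s, ∑ k ∈ t, (c i * c' k) •
      discrepancy (d i + d' k) (opeProd 0 (A i) (A' k)) (opeProd 0 (B i) (B' k)) m l = 0 := by
  ext v
  simp only [discrepancy, smul_sub, Finset.sum_sub_distrib, sub_eq_zero, smul_smul] at hs ht
  simp only [discrepancy, smul_sub, Finset.sum_sub_distrib, LinearMap.sub_apply,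
    LinearMap.sum_apply, LinearMap.smul_apply, LinearMap.zero_apply, sub_eq_zero, smul_smul]
  have e₁ : ∀ i ∈ s, ∀ k ∈ t,
      expansion (d i + d' k) (opeProd 0 (A i) (A' k)) (opeProd 0 (B i) (B' k)) m l v =
      bilocalMul (expansion (d i) (A i) (B i)) (expansion (d' k) (A' k) (B' k)) m l v :=
    fun i hi k hk => expansion_opeProd (h₁ i hi k hk) (h₂ i hi k hk) (h₃ i hi k hk)
      (h₄ i hi k hk) _ _ _ _ _
  have e₂ : ∀ i ∈ s, ∀ k ∈ t,
      expansion (d i + d' k) (opeProd 0 (B i) (B' k)) (opeProd 0 (A i) (A' k)) l m v =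
      bilocalMul (expansion (d i) (B i) (A i)) (expansion (d' k) (B' k) (A' k)) l m v :=
    fun i hi k hk => expansion_opeProd (h₄ i hi k hk) (h₃ i hi k hk) (h₂ i hi k hk)
      (h₁ i hi k hk) _ _ _ _ _
  calc _ = ∑ i ∈ s, ∑ k ∈ t, (c i * c' k) •
        bilocalMul (expansion (d i) (A i) (B i)) (expansion (d' k) (A' k) (B' k)) m l v :=
        Finset.sum_congr rfl fun i hi => Finset.sum_congr rfl fun k hk => by rw [e₁ i hi k hk]
    _ = bilocalMul (fun a b => ∑ i ∈ s, c i • expansion (d i) (A i) (B i) a b)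
          (fun a b => ∑ k ∈ t, c' k • expansion (d' k) (A' k) (B' k) a b) m l v :=
        sum_smul_bilocalMul s t c c' (fun i hi k hk => bilocalMul_support_finite
          (isLowerTruncated_expansion _ _ _) (isLowerTruncated_expansion _ _ _)
          (CommuteModes.commute_expansion (h₁ i hi k hk) (h₂ i hi k hk) (h₃ i hi k hk)
            (h₄ i hi k hk) _ _)) m l v
    -- Regularity of both families: each sum is replaced by its expansion in the opposite domain.
    _ = bilocalMul (fun b a => ∑ i ∈ s, (c i * (-1) ^ d i) • expansion (d i) (B i) (A i) b a)
          (fun b a => ∑ k ∈ t, (c' k * (-1) ^ d' k) • expansion (d' k) (B' k) (A' k) b a)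
          l m v := by
        rw [← bilocalMul_swap]
        simp only [hs, ht]
    _ = ∑ i ∈ s, ∑ k ∈ t, (c i * (-1) ^ d i * (c' k * (-1) ^ d' k)) •
        bilocalMul (expansion (d i) (B i) (A i)) (expansion (d' k) (B' k) (A' k)) l m v :=
        (sum_smul_bilocalMul s t _ _ (fun i hi k hk => bilocalMul_support_finite
          (isLowerTruncated_expansion _ _ _) (isLowerTruncated_expansion _ _ _)
          (CommuteModes.commute_expansion (h₄ i hi k hk) (h₃ i hi k hk) (h₂ i hi k hk)
            (h₁ i hi k hk) _ _)) l m v).symm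
    _ = _ := Finset.sum_congr rfl fun i hi => Finset.sum_congr rfl fun k hk => by
        rw [e₂ i hi k hk, zpow_add₀ (by norm_num : (-1 : ℂ) ≠ 0)]
        congr 1
        ring

/-! ### Linearity of products -/

theorem discrepancy_smul_left (c : ℂ) (d : ℤ) (A B : VertexOperator ℂ V) (m l : ℤ) :
    discrepancy d (c • A) B m l = c • discrepancy d A B m l := by
  ext v
  simp [discrepancy, expansion_apply, smul_finsum, smul_sub, smul_comm c]

theorem discrepancy_smul_right (c : ℂ) (d : ℤ) (A B : VertexOperator ℂ V) (m l : ℤ) :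
    discrepancy d A (c • B) m l = c • discrepancy d A B m l := by
  rw [discrepancy_swap, discrepancy_smul_left, discrepancy_swap d A B]
  module

theorem expansion_add_left (d : ℤ) (A A' B : VertexOperator ℂ V) (m l : ℤ) :
    expansion d (A + A') B m l = expansion d A B m l + expansion d A' B m l := by
  ext v
  rw [LinearMap.add_apply, expansion_apply, expansion_apply, expansion_apply,
    ← finsum_add_distrib (expansion_support_finite d A B m l v)
      (expansion_support_finite d A' B m l v)]
  simp

theorem expansion_add_right (d : ℤ) (A B B' : VertexOperator ℂ V) (m l : ℤ) :
    expansion d A (B + B') m l = expansion d A B m l + expansion d A B' m l := by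
  ext v
  rw [LinearMap.add_apply, expansion_apply, expansion_apply, expansion_apply,
    ← finsum_add_distrib (expansion_support_finite d A B m l v)
      (expansion_support_finite d A B' m l v)]
  simp

theorem opeProd_add_right (p : ℤ) (A B B' : VertexOperator ℂ V) :
    opeProd p A (B + B') = opeProd p A B + opeProd p A B' := by
  refine ext_ncoeff fun m => ?_
  simp only [map_add, Pi.add_apply, opeProd_ncoeff, discrepancy, expansion_add_left,
    expansion_add_right]
  module

theorem opeProd_smul_left (c : ℂ) (p : ℤ) (A B : VertexOperator ℂ V) :
    opeProd p (c • A) B = c • opeProd p A B :=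
  ext_ncoeff fun m => by simp [opeProd_ncoeff, discrepancy_smul_left]

theorem opeProd_neg_left (p : ℤ) (A B : VertexOperator ℂ V) :
    opeProd p (-A) B = -opeProd p A B := by
  rw [← neg_one_smul ℂ A, opeProd_smul_left]
  exact ext_ncoeff fun m => by simp

theorem opeProd_idField_left (A : VertexOperator ℂ V) : opeProd 0 idField A = A := by
  refine ext_ncoeff fun m => LinearMap.ext fun v => ?_
  rw [(CommuteModes.idField_left A).opeProd_zero_apply, finsum_eq_single _ (-1 : ℤ)]
  · simp [idField]
  · intro a ha
    simp [idField, ha]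

theorem opeProd_idField_right (A : VertexOperator ℂ V) : opeProd 0 A idField = A := by
  rw [(CommuteModes.idField_right A).opeProd_zero_comm, opeProd_idField_left]

/-! ### Moving the splitting point of a normal ordered product -/

/-- Multiplied by `z - w`, the exponent `-1` becomes the commutator. Hence each unit moved from `l`
to `m` costs the same mode of `F`, and the correction is linear in `m`. -/
theorem discrepancy_neg_one_eq {A B F : VertexOperator ℂ V}
    (h : ∀ k l, A[[k]] * B[[l]] - B[[l]] * A[[k]] = F[[k + l]]) (m l : ℤ) :
    discrepancy (-1) A B m l = (opeProd 0 A B)[[m + l]] + (m : ℂ) • F[[m + l - 1]] := by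
  have step : ∀ m l, discrepancy (-1) A B (m + 1) l =
      discrepancy (-1) A B m (l + 1) + F[[m + l]] := fun m l => by
    rw [← h, ← discrepancy_zero, ← neg_add_cancel (1 : ℤ), discrepancy_succ]
    simp
  rw [opeProd_zero_ncoeff]
  induction m using Int.induction_on generalizing l with
  | zero => simp
  | succ i ih =>
    rw [step, ih, show (i : ℤ) + (l + 1) = i + 1 + l by ring,
      show (i : ℤ) + 1 + l - 1 = i + l by ring]
    push_cast
    module
  | pred i ih =>
    have := step (-i - 1) (l - 1)
    rw [sub_add_cancel, sub_add_cancel, ih, eq_comm, ← eq_sub_iff_add_eq] at this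
    rw [this, show -(i : ℤ) + (l - 1) = -i - 1 + l by ring,
      show -(i : ℤ) - 1 + (l - 1) = -i - 1 + l - 1 by ring]
    push_cast
    module

theorem CommuteModes.discrepancy_neg_one {A B : VertexOperator ℂ V} (h : CommuteModes A B)
    (m l : ℤ) : discrepancy (-1) A B m l = (opeProd 0 A B)[[m + l]] := by
  rw [discrepancy_neg_one_eq (F := 0) fun k l => by simp [(h k l).eq] ]
  simp

/-! ### One pair of symplectic bosons -/

section Pair

variable {X Y : VertexOperator ℂ V}

/-- The field `-(X Y Y + 2 ∂Y)`, in the form in which it arises as `D_i Y_i`. -/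
def raisedField (X Y : VertexOperator ℂ V) : VertexOperator ℂ V :=
  opeProd 0 (-opeProd 0 X Y) Y + opeProd 0 X (opeProd 0 Y Y) + opeProd 0 (-opeProd 0 X Y) Y

theorem CommuteModes.raisedField_left {C : VertexOperator ℂ V} (hX : CommuteModes X C)
    (hY : CommuteModes Y C) : CommuteModes (raisedField X Y) C :=
  have h := (hX.opeProd_left hY 0).neg_left.opeProd_left hY 0
  (h.add_left (hX.opeProd_left (hY.opeProd_left hY 0) 0)).add_left h

theorem commutator_YX (l k : ℤ)
    (hXY : ∀ m k, X[[m]] * Y[[k]] - Y[[k]] * X[[m]] = idField[[m + k]]) :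
    Y[[l]] * X[[k]] - X[[k]] * Y[[l]] = ((-1 : ℂ) • (idField : VertexOperator ℂ V))[[k + l]] := by
  rw [← neg_sub, hXY]
  simp

theorem commutator_Y_opeProd (hXY : ∀ m k, X[[m]] * Y[[k]] - Y[[k]] * X[[m]] = idField[[m + k]])
    {B : VertexOperator ℂ V} (hB : CommuteModes Y B) (l m : ℤ) :
    Y[[l]] * (opeProd 0 X B)[[m]] - (opeProd 0 X B)[[m]] * Y[[l]] = -B[[m + l]] := by
  rw [opeProd_zero_ncoeff, commutator_discrepancy (B' := 0) (fun k => commutator_YX l k hXY)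
    (fun k => by simp [(hB l k).eq]), discrepancy_smul_left,
    (CommuteModes.idField_left B).discrepancy_neg_one, opeProd_idField_left,
    ← zero_smul ℂ (0 : VertexOperator ℂ V), discrepancy_smul_right]
  simp [add_comm]

theorem commutator_X_YY (hXY : ∀ m k, X[[m]] * Y[[k]] - Y[[k]] * X[[m]] = idField[[m + k]])
    (l m : ℤ) :
    X[[l]] * (opeProd 0 Y Y)[[m]] - (opeProd 0 Y Y)[[m]] * X[[l]] = ((2 : ℂ) • Y)[[m + l]] := by
  rw [opeProd_zero_ncoeff, commutator_discrepancy (c := l)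
    (fun k => (hXY l k).trans (by rw [add_comm])) (fun k => (hXY l k).trans (by rw [add_comm])),
    (CommuteModes.idField_left Y).discrepancy_neg_one,
    (CommuteModes.idField_right Y).discrepancy_neg_one, opeProd_idField_left,
    opeProd_idField_right, map_smul, Pi.smul_apply, two_smul, zero_add, zero_add, add_comm l m]

theorem commutator_X_XYY (hXY : ∀ m k, X[[m]] * Y[[k]] - Y[[k]] * X[[m]] = idField[[m + k]])
    (hXX : CommuteModes X X) (l m : ℤ) :
    X[[l]] * (opeProd 0 X (opeProd 0 Y Y))[[m]] - (opeProd 0 X (opeProd 0 Y Y))[[m]] * X[[l]] =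
      (2 : ℂ) • (opeProd 0 X Y)[[m + l]] := by
  rw [opeProd_zero_ncoeff, commutator_discrepancy (A' := 0) (c := l)
    (fun k => by simp [(hXX l k).eq]) (fun k => commutator_X_YY hXY l k),
    discrepancy_smul_right, opeProd_zero_ncoeff, ← zero_smul ℂ (0 : VertexOperator ℂ V),
    discrepancy_smul_left]
  simp

/-- With `T = XYY`, `Q = YY`, `N = XY`, the Leibniz rule gives the bracket up to the reassociation
defect `(X(YQ)) - (NQ)`. The defect need not be computed: antisymmetry of the bracket determines it.
-/
theorem commutator_XYY_XYY (hXY : ∀ m k, X[[m]] * Y[[k]] - Y[[k]] * X[[m]] = idField[[m + k]])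
    (hXX : CommuteModes X X) (hYY : CommuteModes Y Y) (m l : ℤ) :
    (opeProd 0 X (opeProd 0 Y Y))[[m]] * (opeProd 0 X (opeProd 0 Y Y))[[l]] -
      (opeProd 0 X (opeProd 0 Y Y))[[l]] * (opeProd 0 X (opeProd 0 Y Y))[[m]] =
      (2 * (l - m) : ℂ) • (opeProd 0 Y Y)[[m + l - 1]] := by
  set Q := opeProd 0 Y Y with hQ
  set T := opeProd 0 X Q with hT
  set N := opeProd 0 X Y with hN
  have hYQ : CommuteModes Y Q := hYY.opeProd_right hYY 0
  have hTX : ∀ m l, T[[m]] * X[[l]] - X[[l]] * T[[m]] = ((-2 : ℂ) • N)[[l + m]] := fun m l => by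
    rw [← neg_sub, commutator_X_XYY hXY hXX, add_comm l m]
    simp [hN]
  have hTY : ∀ m l, T[[m]] * Y[[l]] - Y[[l]] * T[[m]] = Q[[l + m]] := fun m l => by
    rw [← neg_sub, commutator_Y_opeProd hXY hYQ, neg_neg, add_comm]
  have hNY : ∀ m l, N[[m]] * Y[[l]] - Y[[l]] * N[[m]] = Y[[l + m]] := fun m l => by
    rw [← neg_sub, commutator_Y_opeProd hXY hYY, neg_neg, add_comm]
  have hTQ : ∀ m l, T[[m]] * Q[[l]] - Q[[l]] * T[[m]] =
      ((2 : ℂ) • opeProd 0 Y Q)[[l + m]] := fun m l => by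
    conv_lhs => rw [hQ, opeProd_zero_ncoeff Y Y l]
    rw [commutator_discrepancy (hTY m) (hTY m), hYQ.symm.discrepancy_neg_one,
      hYQ.discrepancy_neg_one, hYQ.opeProd_zero_comm, zero_add, zero_add, add_comm m l]
    simp [two_smul]
  have hNQ : ∀ m l, N[[m]] * Q[[l]] - Q[[l]] * N[[m]] = ((2 : ℂ) • Q)[[m + l]] := fun m l => by
    conv_lhs => rw [hQ, opeProd_zero_ncoeff Y Y l]
    rw [commutator_discrepancy (hNY m) (hNY m), hYY.discrepancy_neg_one,
      hYY.discrepancy_neg_one, zero_add, zero_add, add_comm l m]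
    simp [two_smul, hQ]
  have key : ∀ m l, T[[m]] * T[[l]] - T[[l]] * T[[m]] =
      (2 : ℂ) • ((opeProd 0 X (opeProd 0 Y Q))[[m + l]] - (opeProd 0 N Q)[[m + l]]) -
        (4 * m : ℂ) • Q[[m + l - 1]] := fun m l => by
    conv_lhs => rw [hT, opeProd_zero_ncoeff X Q l]
    rw [← hT, commutator_discrepancy (hTX m) (hTQ m), discrepancy_smul_left,
      discrepancy_smul_right, discrepancy_neg_one_eq hNQ, ← opeProd_zero_ncoeff, zero_add,
      add_comm l m, map_smul, Pi.smul_apply]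
    module
  -- The defect depends only on `m + l`, so the brackets at `(0, m + l)` and `(m + l, 0)`, which add
  -- up to zero, fix it.
  have h₀ := key 0 (m + l)
  have h₁ := key (m + l) 0
  rw [← neg_sub] at h₁
  simp only [zero_add, add_zero] at h₀ h₁
  rw [h₀] at h₁
  have h₂ : (opeProd 0 X (opeProd 0 Y Q))[[m + l]] - (opeProd 0 N Q)[[m + l]] =
      (m + l : ℂ) • Q[[m + l - 1]] := by
    have h4 : (4 : ℂ) • ((opeProd 0 X (opeProd 0 Y Q))[[m + l]] - (opeProd 0 N Q)[[m + l]]) =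
        (4 : ℂ) • (m + l : ℂ) • Q[[m + l - 1]] := by
      rw [neg_eq_iff_add_eq_zero] at h₁
      rw [← sub_eq_zero, ← h₁]
      push_cast
      module
    exact smul_right_injective _ (by norm_num : (4 : ℂ) ≠ 0) h4
  rw [key, h₂]
  module

/-- `X[[m]]` and `Y[[l]]` fail to commute only for `m + l = -1`, never with both indices negative or
both nonnegative, so `(X(YY)) = (Y(XY))`. Moving `Y` past `XY` then produces the derivative term. -/
theorem raisedField_ncoeff (hXY : ∀ m k, X[[m]] * Y[[k]] - Y[[k]] * X[[m]] = idField[[m + k]])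
    (hYY : CommuteModes Y Y) (m : ℤ) :
    (raisedField X Y)[[m]] =
      (2 * m : ℂ) • Y[[m - 1]] - (opeProd 0 X (opeProd 0 Y Y))[[m]] := by
  have hNY : ∀ m l, (opeProd 0 X Y)[[m]] * Y[[l]] - Y[[l]] * (opeProd 0 X Y)[[m]] = Y[[m + l]] :=
    fun m l => by rw [← neg_sub, commutator_Y_opeProd hXY hYY, neg_neg]
  have hcomm : ∀ m l : ℤ, m + l ≠ -1 → Commute (X[[m]]) (Y[[l]]) := fun m l h => by
    rw [commute_iff_eq, ← sub_eq_zero, hXY, idField, ofModes_ncoeff, if_neg h]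
  have h₁ : opeProd 0 X (opeProd 0 Y Y) = opeProd 0 Y (opeProd 0 X Y) :=
    opeProd_zero_left_comm (fun m l _ _ => hcomm m l (by omega))
      (fun m l _ _ => hcomm m l (by omega)) Y
  have h₂ : (opeProd 0 Y (opeProd 0 X Y))[[m]] =
      (opeProd 0 (opeProd 0 X Y) Y)[[m]] + (m : ℂ) • Y[[m - 1]] := by
    rw [opeProd_zero_ncoeff, discrepancy_swap, discrepancy_neg_one_eq hNY, add_zero]
    simp [add_comm]
  rw [raisedField, opeProd_neg_left]
  simp only [map_add, map_neg, Pi.add_apply, Pi.neg_apply]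
  rw [h₁, h₂]
  module

theorem commutator_raisedField_Y
    (hXY : ∀ m k, X[[m]] * Y[[k]] - Y[[k]] * X[[m]] = idField[[m + k]])
    (hYY : CommuteModes Y Y) (m l : ℤ) :
    (raisedField X Y)[[m]] * Y[[l]] - Y[[l]] * (raisedField X Y)[[m]] =
      -(opeProd 0 Y Y)[[m + l]] := by
  have h := commutator_Y_opeProd hXY (hYY.opeProd_right hYY 0) l m
  rw [raisedField_ncoeff hXY hYY, ← h, sub_mul, mul_sub, smul_mul_assoc, mul_smul_comm,
    (hYY (m - 1) l).eq]
  abel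

/-- The coefficient of `∂Y` is what makes this work: the cross brackets contribute `2(m - l) Q`,
cancelling `2(l - m) Q` from the bracket of `XYY` with itself. -/
theorem commuteModes_raisedField
    (hXY : ∀ m k, X[[m]] * Y[[k]] - Y[[k]] * X[[m]] = idField[[m + k]])
    (hXX : CommuteModes X X) (hYY : CommuteModes Y Y) :
    CommuteModes (raisedField X Y) (raisedField X Y) := fun m l => by
  have h₁ := commutator_Y_opeProd hXY (hYY.opeProd_right hYY 0) (m - 1) l
  have h₂ := commutator_Y_opeProd hXY (hYY.opeProd_right hYY 0) (l - 1) m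
  have h₃ := commutator_XYY_XYY hXY hXX hYY m l
  rw [show l + (m - 1) = m + l - 1 by ring] at h₁
  rw [show m + (l - 1) = m + l - 1 by ring] at h₂
  rw [commute_iff_eq, ← sub_eq_zero, raisedField_ncoeff hXY hYY, raisedField_ncoeff hXY hYY]
  set T := opeProd 0 X (opeProd 0 Y Y)
  set Q := opeProd 0 Y Y
  rw [sub_eq_iff_eq_add] at h₁ h₂ h₃
  simp only [mul_sub, sub_mul, smul_mul_assoc, mul_smul_comm]
  rw [h₁, h₂, h₃, (hYY (m - 1) (l - 1)).eq]
  module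

/-- The residue of the simple pole is `-(YY)_0`. As `Y` commutes with itself, this contribution
equals the discrepancy of `-Y(z) Y(w) / (z - w)`. -/
theorem discrepancy_raisedField_Y
    (hXY : ∀ m k, X[[m]] * Y[[k]] - Y[[k]] * X[[m]] = idField[[m + k]])
    (hYY : CommuteModes Y Y) (m l : ℤ) :
    discrepancy 0 (raisedField X Y) Y m l = -discrepancy (-1) Y Y m l := by
  rw [discrepancy_zero, commutator_raisedField_Y hXY hYY, hYY.discrepancy_neg_one]

theorem discrepancy_Y_raisedField
    (hXY : ∀ m k, X[[m]] * Y[[k]] - Y[[k]] * X[[m]] = idField[[m + k]])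
    (hYY : CommuteModes Y Y) (m l : ℤ) :
    discrepancy 0 Y (raisedField X Y) m l = discrepancy (-1) Y Y m l := by
  rw [discrepancy_swap, discrepancy_raisedField_Y hXY hYY, hYY.discrepancy_neg_one,
    hYY.discrepancy_neg_one, add_comm]
  simp

end Pair

end

end BosonicVOA

namespace BosonicVOA

noncomputable section

/-! ### Factorization of `𝒴_I` -/

namespace SymplecticBosons

variable {n : ℕ} {V : Type*} [AddCommGroup V] [Module ℂ V] (S : SymplecticBosons n V)

theorem commuteModes_XX (i j : Fin n) : CommuteModes (S.X i) (S.X j) := fun m k => by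
  rw [commute_iff_eq, ← sub_eq_zero, S.ope_XX i j]
  simp

theorem commuteModes_YY (i j : Fin n) : CommuteModes (S.Y i) (S.Y j) := fun m k => by
  rw [commute_iff_eq, ← sub_eq_zero, S.ope_YY i j]
  simp

theorem commuteModes_XY {i j : Fin n} (h : i ≠ j) : CommuteModes (S.X i) (S.Y j) :=
  fun m k => by
    rw [commute_iff_eq, ← sub_eq_zero, S.ope_XY i j]
    simp [h]

theorem commutator_XY (i : Fin n) (m k : ℤ) :
    (S.X i)[[m]] * (S.Y i)[[k]] - (S.Y i)[[k]] * (S.X i)[[m]] = idField[[m + k]] := by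
  rw [S.ope_XY i i]
  simp

/-- The field `D_i Y_i`. -/
def Z (i : Fin n) : VertexOperator ℂ V := raisedField (S.X i) (S.Y i)

theorem commuteModes_ZZ_self (i : Fin n) : CommuteModes (S.Z i) (S.Z i) :=
  commuteModes_raisedField (S.commutator_XY i) (S.commuteModes_XX i i) (S.commuteModes_YY i i)

theorem commuteModes_ZX {i j : Fin n} (h : i ≠ j) : CommuteModes (S.Z i) (S.X j) :=
  CommuteModes.raisedField_left (S.commuteModes_XX i j) (S.commuteModes_XY h.symm).symm

theorem commuteModes_ZY {i j : Fin n} (h : i ≠ j) : CommuteModes (S.Z i) (S.Y j) :=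
  CommuteModes.raisedField_left (S.commuteModes_XY h) (S.commuteModes_YY i j)

/-- `D_i` is built from left multiplications by `𝒜_i`, `X_i` and `Y_i`, each of which can be
exchanged with left multiplication by `B`. -/
theorem D_opeProd_of_commuteModes {i : Fin n} {B : VertexOperator ℂ V}
    (hX : CommuteModes (S.X i) B) (hY : CommuteModes (S.Y i) B) (O : VertexOperator ℂ V) :
    S.D i (opeProd 0 B O) = opeProd 0 B (S.D i O) := by
  have hA : CommuteModes (S.A i) B := (hX.opeProd_left hY 0).neg_left
  have comm : ∀ {C : VertexOperator ℂ V}, CommuteModes C B → ∀ O,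
      opeProd 0 C (opeProd 0 B O) = opeProd 0 B (opeProd 0 C O) := fun h O =>
    opeProd_zero_left_comm (fun m l _ _ => h m l) (fun m l _ _ => h m l) O
  rw [D, D, partialD, partialD, hatA, hatA, comm hA, comm hY, comm hX, opeProd_add_right,
    opeProd_add_right]

theorem D_opeProd_Y {i : Fin n} {U : VertexOperator ℂ V} (hX : CommuteModes (S.X i) U)
    (hY : CommuteModes (S.Y i) U) : S.D i (opeProd 0 (S.Y i) U) = opeProd 0 (S.Z i) U := by
  have hZ : CommuteModes (S.Z i) U := CommuteModes.raisedField_left hX hY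
  -- `U` is moved to the left, so that `D_i` passes it and acts on `Y_i` alone.
  rw [hY.opeProd_zero_comm, S.D_opeProd_of_commuteModes hX hY, hZ.opeProd_zero_comm]
  rfl

/-- The `i`-th factor of `𝒴_I`. -/
def factor (I : Finset (Fin n)) (i : Fin n) : VertexOperator ℂ V :=
  if i ∈ I then S.Z i else S.Y i

theorem factor_of_mem {I : Finset (Fin n)} {i : Fin n} (h : i ∈ I) : S.factor I i = S.Z i :=
  if_pos h

theorem factor_of_notMem {I : Finset (Fin n)} {i : Fin n} (h : i ∉ I) : S.factor I i = S.Y i :=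
  if_neg h

theorem factor_congr {I J : Finset (Fin n)} {i : Fin n} (h : i ∈ I ↔ i ∈ J) :
    S.factor I i = S.factor J i := by
  simp only [factor, h]

theorem commuteModes_X_factor {i j : Fin n} (h : i ≠ j) (I : Finset (Fin n)) :
    CommuteModes (S.X i) (S.factor I j) := by
  rw [factor]
  split_ifs
  exacts [(S.commuteModes_ZX h.symm).symm, S.commuteModes_XY h]

theorem commuteModes_Y_factor {i j : Fin n} (h : i ≠ j) (I : Finset (Fin n)) :
    CommuteModes (S.Y i) (S.factor I j) := by
  rw [factor]
  split_ifs
  exacts [(S.commuteModes_ZY h.symm).symm, S.commuteModes_YY i j]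

theorem commuteModes_factor {i j : Fin n} (h : i ≠ j) (I J : Finset (Fin n)) :
    CommuteModes (S.factor I i) (S.factor J j) := by
  rw [factor]
  split_ifs
  exacts [CommuteModes.raisedField_left (S.commuteModes_X_factor h J)
    (S.commuteModes_Y_factor h J), S.commuteModes_Y_factor h J]

/-- The product of the factors of `𝒴_I` over a list of indices. -/
def factorProd (I : Finset (Fin n)) : List (Fin n) → VertexOperator ℂ V
  | [] => idField
  | i :: s => opeProd 0 (S.factor I i) (factorProd I s)

theorem factorProd_congr {I J : Finset (Fin n)} {s : List (Fin n)}
    (h : ∀ i ∈ s, i ∈ I ↔ i ∈ J) : S.factorProd I s = S.factorProd J s := by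
  induction s with
  | nil => rfl
  | cons i s ih =>
    rw [factorProd, factorProd, S.factor_congr (h i (by simp)),
      ih fun j hj => h j (List.mem_cons_of_mem i hj)]

theorem commuteModes_factorProd {C : VertexOperator ℂ V} {I : Finset (Fin n)}
    {s : List (Fin n)} (h : ∀ i ∈ s, CommuteModes C (S.factor I i)) :
    CommuteModes C (S.factorProd I s) := by
  induction s with
  | nil => exact CommuteModes.idField_right C
  | cons i s ih =>
    exact (h i (by simp)).opeProd_right (ih fun j hj => h j (List.mem_cons_of_mem i hj)) 0

theorem D_factorProd {i : Fin n} {I : Finset (Fin n)} (hi : i ∉ I) {s : List (Fin n)}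
    (hs : s.Nodup) (his : i ∈ s) :
    S.D i (S.factorProd I s) = S.factorProd (insert i I) s := by
  induction s with
  | nil => simp at his
  | cons j s ih =>
    rw [List.nodup_cons] at hs
    rw [factorProd, factorProd]
    by_cases hij : i = j
    · subst hij
      have hne : ∀ k ∈ s, i ≠ k := fun k hk h => hs.1 (h ▸ hk)
      rw [S.factor_of_notMem hi, S.factor_of_mem (Finset.mem_insert_self i I), S.D_opeProd_Y
        (S.commuteModes_factorProd fun k hk => S.commuteModes_X_factor (hne k hk) I)
        (S.commuteModes_factorProd fun k hk => S.commuteModes_Y_factor (hne k hk) I),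
        S.factorProd_congr (J := insert i I) fun k hk => by simp [(hne k hk).symm] ]
    · rw [S.D_opeProd_of_commuteModes (S.commuteModes_X_factor hij I)
        (S.commuteModes_Y_factor hij I), ih hs.2 (by simpa [hij] using his),
        S.factor_congr (J := insert i I) (by simp [Ne.symm hij])]

theorem calY_eq_factorProd : S.calY = S.factorProd ∅ (List.finRange n) := by
  rw [calY, List.ofFn_eq_map]
  generalize List.finRange n = s
  induction s with
  | nil => rfl
  | cons i s ih => rw [List.map_cons, List.foldr_cons, ih, factorProd, S.factor_of_notMem (by simp)]

theorem YI_eq_factorProd (I : Finset (Fin n)) : S.YI I = S.factorProd I (List.finRange n) := by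
  have key : ∀ s : List (Fin n), s.Nodup →
      s.foldr S.D S.calY = S.factorProd s.toFinset (List.finRange n) := by
    intro s hs
    induction s with
    | nil => simp [calY_eq_factorProd]
    | cons i s ih =>
      rw [List.nodup_cons] at hs
      rw [List.foldr_cons, ih hs.2, S.D_factorProd (by simpa using hs.1) (List.nodup_finRange n)
        (List.mem_finRange i), List.toFinset_cons]
  rw [YI, key _ (I.sort_nodup _), Finset.sort_toFinset]

/-! ### The relations between the products -/

theorem discrepancy_factor_of_iff {I J : Finset (Fin n)} {i : Fin n} (h : i ∈ I ↔ i ∈ J)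
    (m l : ℤ) : discrepancy 0 (S.factor I i) (S.factor J i) m l = 0 := by
  have hc : CommuteModes (S.factor I i) (S.factor J i) := by
    by_cases hi : i ∈ I
    · rw [S.factor_of_mem hi, S.factor_of_mem (h.1 hi)]
      exact S.commuteModes_ZZ_self i
    · rw [S.factor_of_notMem hi, S.factor_of_notMem (mt h.2 hi)]
      exact S.commuteModes_YY i i
  exact hc.discrepancy_eq_zero 0 m l

theorem discrepancy_factor_of_not_iff {I J : Finset (Fin n)} {i : Fin n}
    (h : ¬(i ∈ I ↔ i ∈ J)) (m l : ℤ) :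
    discrepancy 0 (S.factor I i) (S.factor J i) m l +
      (if i ∈ J then -1 else 1 : ℂ) • discrepancy (-1) (S.Y i) (S.Y i) m l = 0 := by
  by_cases hi : i ∈ I
  · have hj : i ∉ J := fun hj => h (iff_of_true hi hj)
    rw [S.factor_of_mem hi, S.factor_of_notMem hj, if_neg hj, Z,
      discrepancy_raisedField_Y (S.commutator_XY i) (S.commuteModes_YY i i), one_smul,
      neg_add_cancel]
  · have hj : i ∈ J := by_contra fun hj => h (iff_of_false hi hj)
    rw [S.factor_of_notMem hi, S.factor_of_mem hj, if_pos hj, Z,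
      discrepancy_Y_raisedField (S.commutator_XY i) (S.commuteModes_YY i i), neg_one_smul,
      add_neg_cancel]

/-- The product of the one-index relations. An index on which `I` and `J` agree contributes one
term. An index of `symmDiff I J` contributes two, and choosing the pole term puts it into `R`, with
sign `-1` exactly when it lies in `J`. -/
theorem sum_discrepancy_factorProd (I J : Finset (Fin n)) {s : List (Fin n)} (hs : s.Nodup)
    (m l : ℤ) :
    ∑ R ∈ (symmDiff I J ∩ s.toFinset).powerset, ((-1 : ℂ) ^ (R ∩ J).card) •
      discrepancy (-(R.card : ℤ)) (S.factorProd (I \ R) s) (S.factorProd (J \ R) s) m l = 0 := by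
  induction s generalizing m l with
  | nil => simpa [factorProd] using
      (CommuteModes.idField_left (idField : VertexOperator ℂ V)).discrepancy_eq_zero 0 m l
  | cons i s ih =>
    rw [List.nodup_cons] at hs
    have his : i ∉ symmDiff I J ∩ s.toFinset := fun h => hs.1 (by simpa using
      (Finset.mem_inter.1 h).2)
    have hne : ∀ k ∈ s, i ≠ k := fun k hk h => hs.1 (h ▸ hk)
    have hmem : ∀ R ∈ (symmDiff I J ∩ s.toFinset).powerset, i ∉ R := fun R hR h =>
      his (Finset.mem_powerset.1 hR h)
    have hc : ∀ (K L : Finset (Fin n)), CommuteModes (S.factor K i) (S.factorProd L s) :=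
      fun K L => S.commuteModes_factorProd fun k hk => S.commuteModes_factor (hne k hk) K L
    have h₀ : ∀ (K : Finset (Fin n)), ∀ R ∈ (symmDiff I J ∩ s.toFinset).powerset,
        S.factor (K \ R) i = S.factor K i := fun K R hR =>
      S.factor_congr (by simp [hmem R hR])
    rw [List.toFinset_cons]
    by_cases hi : i ∈ I ↔ i ∈ J
    · rw [Finset.inter_insert_of_notMem (by simp only [Finset.mem_symmDiff]; tauto)]
      have := sum_smul_discrepancy_opeProd (Finset.univ : Finset Unit)
        (symmDiff I J ∩ s.toFinset).powerset (fun _ => 1) (fun R => (-1 : ℂ) ^ (R ∩ J).card)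
        (fun _ => 0) (fun R => -(R.card : ℤ)) (fun _ => S.factor I i) (fun _ => S.factor J i)
        (fun R => S.factorProd (I \ R) s) (fun R => S.factorProd (J \ R) s)
        (fun _ _ _ _ => hc _ _) (fun _ _ _ _ => hc _ _) (fun _ _ _ _ => hc _ _)
        (fun _ _ _ _ => hc _ _) (fun m l => by
          simpa using S.discrepancy_factor_of_iff hi m l) (ih hs.2) m l
      simp only [Finset.univ_unique, Finset.sum_singleton, one_mul, zero_add] at this
      rw [← this]
      refine Finset.sum_congr rfl fun R hR => ?_
      rw [factorProd, factorProd, h₀ I R hR, h₀ J R hR]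
    · have hmi : i ∈ symmDiff I J := by rw [Finset.mem_symmDiff]; tauto
      rw [Finset.inter_insert_of_mem hmi, Finset.sum_powerset_insert his]
      -- `true` stands for the pole term, i.e. for `i ∈ R`; both its factors are `Y_i`.
      have := sum_smul_discrepancy_opeProd (Finset.univ : Finset Bool)
        (symmDiff I J ∩ s.toFinset).powerset
        (fun b => if b then (if i ∈ J then -1 else 1) else 1)
        (fun R => (-1 : ℂ) ^ (R ∩ J).card)
        (fun b => if b then -1 else 0) (fun R => -(R.card : ℤ))
        (fun b => if b then S.factor (I \ {i}) i else S.factor I i)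
        (fun b => if b then S.factor (J \ {i}) i else S.factor J i)
        (fun R => S.factorProd (I \ R) s) (fun R => S.factorProd (J \ R) s)
        (fun b _ _ _ => by cases b <;> exact hc _ _)
        (fun b _ _ _ => by cases b <;> exact hc _ _)
        (fun b _ _ _ => by cases b <;> exact hc _ _)
        (fun b _ _ _ => by cases b <;> exact hc _ _)
        (fun m l => by
          have := S.discrepancy_factor_of_not_iff hi m l
          rw [add_comm] at this
          simpa [S.factor_of_notMem] using this) (ih hs.2) m l
      simp only [Fintype.univ_bool, Finset.mem_singleton, Bool.true_eq_false, not_false_eq_true,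
        Finset.sum_insert, Finset.sum_singleton, if_true, Bool.false_eq_true, if_false, one_mul,
        zero_add] at this
      rw [← this, add_comm]
      congr 1
      · refine Finset.sum_congr rfl fun R hR => ?_
        have hiR := hmem R hR
        have e₁ : ∀ K : Finset (Fin n), S.factorProd (K \ insert i R) (i :: s) =
            opeProd 0 (S.factor (K \ {i}) i) (S.factorProd (K \ R) s) := fun K => by
          rw [factorProd, S.factor_congr (J := K \ {i}) (by simp),
            S.factorProd_congr (J := K \ R) fun k hk => by simp [(hne k hk).symm] ]
        rw [e₁, e₁, Finset.card_insert_of_notMem hiR, Nat.cast_succ, neg_add, add_comm (-(R.card : ℤ))]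
        congr 1
        by_cases hJ : i ∈ J
        · rw [Finset.insert_inter_of_mem hJ, Finset.card_insert_of_notMem (by simp [hiR]),
            if_pos hJ, pow_succ']
        · rw [Finset.insert_inter_of_notMem hJ, if_neg hJ, one_mul]
      · refine Finset.sum_congr rfl fun R hR => ?_
        rw [factorProd, factorProd, h₀ I R hR, h₀ J R hR]

theorem sum_discrepancy_YI (I J : Finset (Fin n)) (q : ℕ) (m l : ℤ) :
    ∑ R ∈ (symmDiff I J).powerset, ((-1 : ℂ) ^ (R ∩ J).card) •
      discrepancy (q - (R.card : ℤ)) (S.YI (I \ R)) (S.YI (J \ R)) m l = 0 := by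
  induction q generalizing m l with
  | zero =>
    have := S.sum_discrepancy_factorProd I J (List.nodup_finRange n) m l
    simpa [YI_eq_factorProd, List.toFinset_finRange] using this
  | succ q ih =>
    have := congrArg₂ (· - ·) (ih (m + 1) l) (ih m (l + 1))
    simp only [← Finset.sum_sub_distrib, ← smul_sub, ← discrepancy_succ, sub_zero] at this
    rw [← this]
    refine Finset.sum_congr rfl fun R _ => ?_
    rw [Nat.cast_succ, add_sub_right_comm]

end SymplecticBosons

end

end BosonicVOA

namespace BosonicVOA

noncomputable section

/-! ### Solving the relations -/

section Inversion

variable {α E : Type*} [DecidableEq α] [AddCommGroup E] [Module ℂ E]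

/-- A truncated alternating sum of a row of Pascal's triangle telescopes to one entry of the
previous row. -/
theorem sum_powerset_neg_one_pow_card_le {α : Type*} (R : Finset α) (hR : R.Nonempty) (q : ℕ) :
    ∑ T ∈ R.powerset, (if T.card ≤ q then (-1 : ℂ) ^ T.card else 0) =
      (-1) ^ q * ((R.card - 1).choose q : ℂ) := by
  obtain ⟨N, hN⟩ : ∃ N, R.card = N + 1 := ⟨R.card - 1, by have := hR.card_pos; omega⟩
  have h := Int.alternating_sum_range_choose_eq_choose (n := N) (m := q)
  rw [Finset.sum_powerset_apply_card (fun k => if k ≤ q then (-1 : ℂ) ^ k else 0), hN]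
  have h' := congrArg (Int.cast : ℤ → ℂ) h
  push_cast at h'
  rw [Nat.add_sub_cancel, ← h']
  -- Both sums are extended to a common range: binomial coefficients vanish beyond `N + 1`, the
  -- truncated signs beyond `q`.
  have e₁ : ∀ K, N + 1 < K → q < K → ∑ k ∈ Finset.range (N + 1 + 1),
      (N + 1).choose k • (if k ≤ q then (-1 : ℂ) ^ k else 0) =
      ∑ k ∈ Finset.range K, (N + 1).choose k • (if k ≤ q then (-1 : ℂ) ^ k else 0) :=
    fun K hK _ => Finset.sum_subset (Finset.range_mono hK) fun k _ hk => by
      rw [Finset.mem_range, not_lt] at hk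
      rw [Nat.choose_eq_zero_of_lt (by omega), zero_smul]
  have e₂ : ∀ K, N + 1 < K → q < K → ∑ k ∈ Finset.range (q + 1),
      (-1 : ℂ) ^ k * ((N + 1).choose k : ℂ) =
      ∑ k ∈ Finset.range K, (N + 1).choose k • (if k ≤ q then (-1 : ℂ) ^ k else 0) :=
    fun K _ hK => by
      rw [← Finset.sum_subset (Finset.range_mono hK) fun k _ hk => by
        rw [Finset.mem_range, not_lt] at hk
        rw [if_neg (by omega), smul_zero] ]
      refine Finset.sum_congr rfl fun k hk => ?_
      rw [Finset.mem_range] at hk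
      rw [if_pos (by omega), nsmul_eq_mul, mul_comm]
  rw [e₁ (N + q + 2) (by omega) (by omega), e₂ (N + q + 2) (by omega) (by omega)]

/-- The relations indexed by `T` are added with weights `(-1)^|T|`, cut off at `|T| ≤ q` because
they are available only for the natural exponents `q - |T|`. -/
theorem eq_sum_powerset_of_relations (S : Finset α) (f : Finset α → ℤ → E)
    (h : ∀ T ⊆ S, ∀ q : ℕ, ∑ R ∈ (S \ T).powerset, f (T ∪ R) (q - R.card) = 0) (q : ℕ) :
    f ∅ q = ∑ R ∈ S.powerset.erase ∅,
      ((-1 : ℂ) ^ (q + 1) * ((R.card - 1).choose q : ℂ)) • f R (q - R.card) := by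
  have h₁ : ∀ T ∈ S.powerset, (if T.card ≤ q then (-1 : ℂ) ^ T.card else 0) •
      ∑ R ∈ S.powerset.filter (T ⊆ ·), f R (q - R.card) = 0 := fun T hT => by
    rw [Finset.mem_powerset] at hT
    split_ifs with hq
    · rw [← smul_zero ((-1 : ℂ) ^ T.card), ← h T hT (q - T.card)]
      congr 1
      refine Finset.sum_bij' (fun R _ => R \ T) (fun R _ => T ∪ R) ?_ ?_ ?_ ?_ ?_
      · intro R hR
        rw [Finset.mem_filter, Finset.mem_powerset] at hR
        exact Finset.mem_powerset.2 (Finset.sdiff_subset_sdiff hR.1 subset_rfl)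
      · intro R hR
        rw [Finset.mem_powerset] at hR
        rw [Finset.mem_filter, Finset.mem_powerset]
        exact ⟨Finset.union_subset hT (hR.trans Finset.sdiff_subset), Finset.subset_union_left⟩
      · intro R hR
        exact Finset.union_sdiff_of_subset (Finset.mem_filter.1 hR).2
      · intro R hR
        rw [Finset.mem_powerset] at hR
        exact Finset.union_sdiff_cancel_left
          (Finset.disjoint_of_subset_right hR Finset.disjoint_sdiff)
      · intro R hR
        have hTR := (Finset.mem_filter.1 hR).2
        have := Finset.card_le_card hTR
        rw [Finset.union_sdiff_of_subset hTR, Finset.card_sdiff_of_subset hTR]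
        congr 1
        omega
    · rw [zero_smul]
  have h₂ : ∑ R ∈ S.powerset, (∑ T ∈ R.powerset, if T.card ≤ q then (-1 : ℂ) ^ T.card else 0) •
      f R (q - R.card) = 0 := by
    rw [← Finset.sum_eq_zero h₁]
    simp only [Finset.sum_smul, Finset.smul_sum]
    refine Finset.sum_comm' fun R T => ?_
    simp only [Finset.mem_powerset, Finset.mem_filter]
    exact ⟨fun ⟨hR, hT⟩ => ⟨⟨hR, hT⟩, hT.trans hR⟩, fun ⟨⟨hR, hT⟩, _⟩ => ⟨hR, hT⟩⟩
  rw [← Finset.add_sum_erase _ _ (Finset.empty_mem_powerset S)] at h₂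
  simp only [Finset.powerset_empty, Finset.sum_singleton, Finset.card_empty, zero_le, if_true,
    pow_zero, one_smul, Nat.cast_zero, sub_zero] at h₂
  rw [eq_neg_of_add_eq_zero_left h₂, ← Finset.sum_neg_distrib]
  refine Finset.sum_congr rfl fun R hR => ?_
  rw [sum_powerset_neg_one_pow_card_le R
    (Finset.nonempty_iff_ne_empty.2 (Finset.ne_of_mem_erase hR))]
  module

end Inversion

/-- A single set `R ⊆ symmDiff I J` encodes all four summation variables: `R ∩ I` and `R ∩ J` are
the parts removed from `L` and `M`, and `a`, `b` are their sizes. -/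
theorem sum_indexSet {n : ℕ} {E : Type*} [AddCommMonoid E] (I J : Finset (Fin n)) (p : ℕ)
    (F : ℕ → ℕ → Finset (Fin n) → Finset (Fin n) → E) :
    ∑ ab ∈ indexSet (I \ (I ∩ J)) (J \ (I ∩ J)) p, ∑ L' ∈ removed (I \ (I ∩ J)) ab.1,
      ∑ M' ∈ removed (J \ (I ∩ J)) ab.2, F ab.1 ab.2 (I ∩ J ∪ L') (I ∩ J ∪ M') =
    ∑ R ∈ (symmDiff I J).powerset.filter (p ≤ ·.card),
      F (R ∩ I).card (R ∩ J).card (I \ R) (J \ R) := by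
  simp only [Finset.sum_sigma']
  have card_eq : ∀ R ⊆ symmDiff I J, R.card = (R ∩ I).card + (R ∩ J).card := fun R hR => by
    rw [← Finset.card_union_of_disjoint]
    · congr 1
      ext x
      have := @hR x
      simp only [Finset.mem_symmDiff, Finset.mem_union, Finset.mem_inter] at this ⊢
      tauto
    · rw [Finset.disjoint_left]
      intro x hx hx'
      have := @hR x
      simp only [Finset.mem_symmDiff, Finset.mem_inter] at this hx hx'
      tauto
  symm
  refine Finset.sum_bij'
    (fun R _ => ⟨((R ∩ I).card, (R ∩ J).card), (I \ (I ∩ J)) \ R, (J \ (I ∩ J)) \ R⟩)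
    (fun x _ => ((I \ (I ∩ J)) \ x.2.1) ∪ ((J \ (I ∩ J)) \ x.2.2)) ?_ ?_ ?_ ?_ ?_
  · intro R hR
    rw [Finset.mem_filter, Finset.mem_powerset] at hR
    have hc := card_eq R hR.1
    have key : ∀ I J : Finset (Fin n), R ⊆ symmDiff I J → ((I \ (I ∩ J)) \ R).card +
        (R ∩ I).card = (I \ (I ∩ J)).card := fun I J hR => by
      rw [← Finset.card_sdiff_add_card_inter (I \ (I ∩ J)) R]
      congr 2
      ext x
      have := @hR x
      simp only [Finset.mem_symmDiff, Finset.mem_inter, Finset.mem_sdiff] at this ⊢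
      tauto
    have k₁ := key I J hR.1
    have k₂ := key J I (by rw [symmDiff_comm]; exact hR.1)
    rw [Finset.inter_comm J I] at k₂
    simp only [Finset.mem_sigma, indexSet, removed, Finset.mem_filter, Finset.mem_product,
      Finset.mem_range, Finset.mem_powerset, Finset.sdiff_subset, true_and]
    omega
  · rintro ⟨⟨a, b⟩, L', M'⟩ hx
    simp only [Finset.mem_sigma, indexSet, removed, Finset.mem_filter, Finset.mem_product,
      Finset.mem_range, Finset.mem_powerset] at hx
    obtain ⟨hab, ⟨hL, ha⟩, hM, hb⟩ := hx
    rw [Finset.mem_filter, Finset.mem_powerset, Finset.card_union_of_disjoint,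
      Finset.card_sdiff_of_subset hL, Finset.card_sdiff_of_subset hM]
    · refine ⟨fun x => ?_, by omega⟩
      simp only [Finset.mem_symmDiff, Finset.mem_union, Finset.mem_inter, Finset.mem_sdiff]
      tauto
    · rw [Finset.disjoint_left]
      intro x
      simp only [Finset.mem_inter, Finset.mem_sdiff]
      tauto
  · intro R hR
    rw [Finset.mem_filter, Finset.mem_powerset] at hR
    ext x
    have := @hR.1 x
    simp only [Finset.mem_symmDiff, Finset.mem_union, Finset.mem_inter, Finset.mem_sdiff] at this ⊢
    tauto
  · rintro ⟨⟨a, b⟩, L', M'⟩ hx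
    simp only [Finset.mem_sigma, indexSet, removed, Finset.mem_filter, Finset.mem_product,
      Finset.mem_range, Finset.mem_powerset] at hx
    obtain ⟨hab, ⟨hL, ha⟩, hM, hb⟩ := hx
    have i₁ : ((I \ (I ∩ J)) \ L' ∪ (J \ (I ∩ J)) \ M') ∩ I = (I \ (I ∩ J)) \ L' := by
      ext x
      simp only [Finset.mem_union, Finset.mem_inter, Finset.mem_sdiff]
      tauto
    have i₂ : ((I \ (I ∩ J)) \ L' ∪ (J \ (I ∩ J)) \ M') ∩ J = (J \ (I ∩ J)) \ M' := by
      ext x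
      simp only [Finset.mem_union, Finset.mem_inter, Finset.mem_sdiff]
      tauto
    have i₃ : (I \ (I ∩ J)) \ ((I \ (I ∩ J)) \ L' ∪ (J \ (I ∩ J)) \ M') = L' := by
      ext x
      have := @hL x
      simp only [Finset.mem_union, Finset.mem_inter, Finset.mem_sdiff] at this ⊢
      tauto
    have i₄ : (J \ (I ∩ J)) \ ((I \ (I ∩ J)) \ L' ∪ (J \ (I ∩ J)) \ M') = M' := by
      ext x
      have := @hM x
      simp only [Finset.mem_union, Finset.mem_inter, Finset.mem_sdiff] at this ⊢
      tauto
    have c₁ : ((I \ (I ∩ J)) \ L').card = a := by rw [Finset.card_sdiff_of_subset hL]; omega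
    have c₂ : ((J \ (I ∩ J)) \ M').card = b := by rw [Finset.card_sdiff_of_subset hM]; omega
    simp only [i₁, i₂, i₃, i₄, c₁, c₂]
  · intro R hR
    rw [Finset.mem_filter, Finset.mem_powerset] at hR
    have key : ∀ I J : Finset (Fin n), R ⊆ symmDiff I J →
        I \ R = I ∩ J ∪ (I \ (I ∩ J)) \ R := fun I J hR => by
      ext x
      have := @hR x
      simp only [Finset.mem_symmDiff, Finset.mem_union, Finset.mem_inter, Finset.mem_sdiff] at this ⊢
      tauto
    have k₂ := key J I (by rw [symmDiff_comm]; exact hR.1)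
    rw [Finset.inter_comm J I] at k₂
    simp only [← key I J hR.1, ← k₂]

variable {V : Type*} [AddCommGroup V] [Module ℂ V]

/-! ### Derivatives -/

/-- Coefficients of `∂_w (z - w) ^ d = -d (z - w) ^ (d - 1)`; the next lemma is the analogue for
`∂_z`. -/
theorem succ_mul_binomCoeff_succ (d : ℤ) (j : ℕ) :
    ((j : ℂ) + 1) * binomCoeff d (j + 1) = -(d * binomCoeff (d - 1) j) := by
  have h := Ring.choose_smul_choose d (Nat.succ_le_succ (Nat.zero_le j))
  have h' := congrArg (Int.cast : ℤ → ℂ) h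
  simp only [Nat.succ_eq_add_one, zero_add, Nat.choose_one_right, Ring.choose_one_right,
    nsmul_eq_mul, Nat.add_sub_cancel] at h'
  push_cast at h'
  rw [binomCoeff, binomCoeff, pow_succ]
  linear_combination (-1 : ℂ) ^ (j + 1) * h'

theorem sub_mul_binomCoeff (d : ℤ) (j : ℕ) :
    ((d : ℂ) - j) * binomCoeff d j = d * binomCoeff (d - 1) j := by
  cases j with
  | zero => simp
  | succ j =>
    have h₁ := succ_mul_binomCoeff_succ d j
    have h₂ := binomCoeff_succ_succ (d - 1) j
    rw [sub_add_cancel] at h₂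
    push_cast
    linear_combination (d : ℂ) * h₂ - h₁

/-- Integration by parts in `z`; at index `0` no power of `z` is differentiated. -/
theorem expansion_fieldDeriv_left (d : ℤ) (A B : VertexOperator ℂ V) (l : ℤ) :
    expansion d (fieldDeriv A) B 0 l = (-(d : ℂ)) • expansion (d - 1) A B 0 l := by
  ext v
  rw [LinearMap.smul_apply, expansion_apply, expansion_apply, smul_finsum]
  refine finsum_congr fun j => ?_
  rw [fieldDeriv, ofModes_ncoeff, LinearMap.smul_apply, smul_smul, smul_smul, neg_mul,
    ← sub_mul_binomCoeff, zero_add, zero_add, sub_right_comm]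
  push_cast
  congr 1
  ring

theorem expansion_fieldDeriv_right (d : ℤ) (A B : VertexOperator ℂ V) (l : ℤ) :
    expansion d B (fieldDeriv A) l 0 = (d : ℂ) • expansion (d - 1) B A l 0 := by
  ext v
  obtain ⟨N₁, h₁⟩ := exists_nat_forall_ncoeff_eq_zero (fieldDeriv A) 0 v
  obtain ⟨N₂, h₂⟩ := exists_nat_forall_ncoeff_eq_zero A 0 v
  rw [LinearMap.smul_apply, expansion_eq_sum _ _ _ _ _ _ (N₁ + N₂ + 1) (h₁ _ (by omega)),
    expansion_eq_sum _ _ _ _ _ _ (N₁ + N₂) (h₂ _ (by omega)), Finset.sum_range_succ',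
    Finset.smul_sum]
  simp only [fieldDeriv, ofModes_ncoeff, LinearMap.smul_apply, map_smul, smul_smul]
  -- The term `j = 0` vanishes because `(∂A)[[0]] = 0`.
  rw [add_eq_left.2 (by simp)]
  refine Finset.sum_congr rfl fun j _ => ?_
  have := succ_mul_binomCoeff_succ d j
  rw [show l + d - ((j + 1 : ℕ) : ℤ) = l + (d - 1) - j by push_cast; ring,
    show 0 + ((j + 1 : ℕ) : ℤ) - 1 = 0 + j by push_cast; ring]
  congr 1
  push_cast
  linear_combination -this

theorem opeProd_fieldDeriv_left (p : ℤ) (A B : VertexOperator ℂ V) :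
    opeProd p (fieldDeriv A) B = (1 - p : ℂ) • opeProd (p - 1) A B := by
  refine ext_ncoeff fun m => ?_
  rw [map_smul, Pi.smul_apply, opeProd_ncoeff, opeProd_ncoeff, discrepancy, discrepancy,
    expansion_fieldDeriv_left, expansion_fieldDeriv_right,
    zpow_sub_one₀ (by norm_num : (-1 : ℂ) ≠ 0) (p - 1)]
  push_cast
  module

theorem opeProd_zero_iterate_fieldDeriv (k : ℕ) (A B : VertexOperator ℂ V) :
    opeProd 0 (fieldDeriv^[k] A) B = (k.factorial : ℂ) • opeProd (-k) A B := by
  induction k generalizing A with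
  | zero => simp
  | succ k ih =>
    rw [Function.iterate_succ_apply, ih, opeProd_fieldDeriv_left, smul_smul,
      Nat.factorial_succ, Nat.cast_succ, neg_add, ← sub_eq_add_neg]
    congr 1
    push_cast
    ring

/-! ### Operator product expansions from locality -/

theorem eq_zero_of_shift_eq_of_zero {E : Type*} [AddCommGroup E] {H : ℤ → ℤ → E}
    (hH : ∀ m l, H (m + 1) l = H m (l + 1)) (h0 : ∀ l, H 0 l = 0) (m l : ℤ) : H m l = 0 := by
  induction m using Int.induction_on generalizing l with
  | zero => exact h0 l
  | succ i ih => rw [hH, ih]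
  | pred i ih =>
    have := hH (-i - 1) (l - 1)
    rwa [sub_add_cancel, sub_add_cancel, ih, eq_comm] at this

/-- This is `z ^ m = ∑ C(m, j) (z - w) ^ j w ^ (m - j)`, cut off by locality. Both sides agree at `m
= 0`, and after multiplication by `z - w` by induction on `N`. -/
theorem discrepancy_eq_sum {A B : VertexOperator ℂ V} (N d : ℕ)
    (h : ∀ m l, discrepancy ((d + N : ℕ) : ℤ) A B m l = 0) (m l : ℤ) :
    discrepancy d A B m l = ∑ j ∈ Finset.range N,
      ((Ring.choose m j : ℤ) : ℂ) • discrepancy ((d + j : ℕ) : ℤ) A B 0 (m + l - j) := by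
  induction N generalizing d m l with
  | zero => simpa using h m l
  | succ N ih =>
    rw [← sub_eq_zero]
    refine eq_zero_of_shift_eq_of_zero (H := fun m l => discrepancy d A B m l -
      ∑ j ∈ Finset.range (N + 1),
        ((Ring.choose m j : ℤ) : ℂ) • discrepancy ((d + j : ℕ) : ℤ) A B 0 (m + l - j))
      (fun m l => ?_) (fun l => ?_) m l
    · have h₁ := ih (d + 1) (fun m l => by rw [add_right_comm, add_assoc]; exact h m l) m l
      rw [Nat.cast_succ, discrepancy_succ] at h₁
      rw [sub_eq_sub_iff_sub_eq_sub, h₁, Finset.sum_range_succ', Finset.sum_range_succ' (n := N)]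
      simp only [Ring.choose_succ_succ, Ring.choose_zero_right, Int.cast_add, add_smul,
        Finset.sum_add_distrib, Int.cast_one, one_smul]
      rw [show m + 1 + l = m + (l + 1) by ring, add_assoc, add_sub_cancel_right]
      refine Finset.sum_congr rfl fun j _ => ?_
      rw [show d + 1 + j = d + (j + 1) by ring,
        show m + (l + 1) - ((j + 1 : ℕ) : ℤ) = m + l - j by push_cast; ring]
    · simp only [Finset.sum_range_succ', Ring.choose_zero_succ]
      simp

theorem hasOPE_of_discrepancy_eq_zero {A B : VertexOperator ℂ V} {N : ℕ}
    (h : ∀ m l, discrepancy N A B m l = 0) {C : ℕ → VertexOperator ℂ V}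
    (hC : ∀ p : ℕ, 1 ≤ p → p ≤ N → C p = opeProd p A B) : HasOPE A B N C := fun m k => by
  have hIcc : Finset.Icc 1 N = Finset.Ico 1 (N + 1) := by
    ext
    simp only [Finset.mem_Icc, Finset.mem_Ico]
    omega
  rw [← discrepancy_zero, ← Nat.cast_zero, discrepancy_eq_sum N 0 (by simpa using h), hIcc,
    Finset.sum_Ico_eq_sum_range, Nat.add_sub_cancel]
  refine Finset.sum_congr rfl fun j hj => ?_
  rw [Finset.mem_range] at hj
  rw [hC _ (by omega) (by omega), opeProd_ncoeff, Nat.add_sub_cancel_left]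
  congr 2 <;> push_cast <;> ring

/-! ### Products of `𝒴_I` and `𝒴_J` -/

namespace SymplecticBosons

variable {n : ℕ} (S : SymplecticBosons n V)

theorem discrepancy_YI (I J : Finset (Fin n)) (q : ℕ) (m l : ℤ) :
    discrepancy q (S.YI I) (S.YI J) m l =
      ∑ R ∈ (symmDiff I J).powerset.filter (q + 1 ≤ ·.card),
        ((-1 : ℂ) ^ (((R ∩ J).card : ℤ) - (q + 1)) *
          (((R ∩ I).card + (R ∩ J).card - 1).choose q : ℂ)) •
          discrepancy (q - (R ∩ I).card - (R ∩ J).card) (S.YI (I \ R)) (S.YI (J \ R)) m l := by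
  have h := eq_sum_powerset_of_relations (symmDiff I J) (fun R q => ((-1 : ℂ) ^ (R ∩ J).card) •
      discrepancy q (S.YI (I \ R)) (S.YI (J \ R)) m l) (fun T hT q => ?_) q
  · simp only [Finset.empty_inter, Finset.card_empty, pow_zero, one_smul, Finset.sdiff_empty] at h
    rw [h]
    symm
    -- Nonempty `R` with `|R| ≤ q` drop out because `C(|R| - 1, q) = 0`.
    refine Finset.sum_subset_zero_on_sdiff (fun R hR => ?_) (fun R hR => ?_) fun R hR => ?_
    · rw [Finset.mem_filter] at hR
      refine Finset.mem_erase.2 ⟨?_, hR.1⟩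
      rintro rfl
      simp at hR
    · rw [Finset.mem_sdiff, Finset.mem_erase, Finset.mem_filter, not_and] at hR
      have h₁ := hR.2 hR.1.2
      have h₂ := Finset.card_pos.2 (Finset.nonempty_iff_ne_empty.2 hR.1.1)
      rw [Nat.choose_eq_zero_of_lt (by omega)]
      simp
    · have hRS := Finset.mem_powerset.1 (Finset.mem_filter.1 hR).1
      have hc : R.card = (R ∩ I).card + (R ∩ J).card := by
        rw [← Finset.card_union_of_disjoint]
        · congr 1
          ext x
          have := @hRS x
          simp only [Finset.mem_symmDiff, Finset.mem_union, Finset.mem_inter] at this ⊢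
          tauto
        · rw [Finset.disjoint_left]
          intro x hx hx'
          have := @hRS x
          simp only [Finset.mem_symmDiff, Finset.mem_inter] at this hx hx'
          tauto
      rw [smul_smul, hc, Nat.cast_add, ← sub_sub (q : ℤ)]
      congr 1
      rw [← Nat.cast_succ, zpow_sub₀ (by norm_num : (-1 : ℂ) ≠ 0), zpow_natCast, zpow_natCast,
        div_eq_mul_inv, ← inv_pow, inv_neg_one, Nat.succ_eq_add_one]
      ring
  -- The relation for `T` is the regularity statement for `I \ T` and `J \ T`, with the sign of `T`
  -- as a common factor.
  · have hS : symmDiff I J \ T = symmDiff (I \ T) (J \ T) := by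
      ext x
      simp only [Finset.mem_symmDiff, Finset.mem_sdiff]
      tauto
    have := congrArg (fun x => ((-1 : ℂ) ^ (T ∩ J).card) • x)
      (S.sum_discrepancy_YI (I \ T) (J \ T) q m l)
    simp only [smul_zero, Finset.smul_sum] at this
    rw [hS, ← this]
    refine Finset.sum_congr rfl fun R hR => ?_
    have hRT : Disjoint T R := by
      rw [← hS, Finset.mem_powerset] at hR
      exact Finset.disjoint_of_subset_right hR Finset.disjoint_sdiff
    have hJ : R ∩ (J \ T) = R ∩ J := by
      ext x
      have : x ∈ T → x ∉ R := fun h => Finset.disjoint_left.1 hRT h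
      simp only [Finset.mem_inter, Finset.mem_sdiff]
      tauto
    rw [smul_smul, hJ, ← pow_add, Finset.union_inter_distrib_right, Finset.card_union_of_disjoint
      (hRT.mono Finset.inter_subset_left Finset.inter_subset_left), sdiff_sdiff_left,
      sdiff_sdiff_left]
    rfl

theorem discrepancy_YI_eq_zero (I J : Finset (Fin n)) {q : ℕ} (hq : (symmDiff I J).card ≤ q)
    (m l : ℤ) : discrepancy q (S.YI I) (S.YI J) m l = 0 := by
  rw [discrepancy_YI, Finset.filter_false_of_mem, Finset.sum_empty]
  intro R hR
  have := Finset.card_le_card (Finset.mem_powerset.1 hR)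
  omega

theorem opeProd_YI_eq_zero (I J : Finset (Fin n)) {p : ℕ} (hp : (symmDiff I J).card + 1 ≤ p) :
    opeProd p (S.YI I) (S.YI J) = 0 := by
  refine ext_ncoeff fun m => ?_
  have := S.discrepancy_YI_eq_zero I J (q := p - 1) (by omega) 0 m
  rw [Nat.cast_sub (by omega)] at this
  simpa [opeProd_ncoeff] using this

theorem opeProd_YI (I J : Finset (Fin n)) {p : ℕ} (hp : 1 ≤ p) :
    opeProd p (S.YI I) (S.YI J) =
      ∑ ab ∈ indexSet (I \ (I ∩ J)) (J \ (I ∩ J)) p, ∑ L' ∈ removed (I \ (I ∩ J)) ab.1,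
        ∑ M' ∈ removed (J \ (I ∩ J)) ab.2,
          ((-1 : ℂ) ^ ((ab.2 : ℤ) - p) * ((ab.1 + ab.2 - 1).choose (p - 1) : ℂ)) •
            opeProd ((p : ℤ) - ab.1 - ab.2) (S.YI (I ∩ J ∪ L')) (S.YI (I ∩ J ∪ M')) := by
  obtain ⟨q, rfl⟩ : ∃ q, p = q + 1 := ⟨p - 1, by omega⟩
  rw [sum_indexSet I J (q + 1) fun a b L' M' =>
    ((-1 : ℂ) ^ ((b : ℤ) - (q + 1 : ℕ)) * ((a + b - 1).choose (q + 1 - 1) : ℂ)) •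
      opeProd (((q + 1 : ℕ) : ℤ) - a - b) (S.YI L') (S.YI M')]
  refine ext_ncoeff fun m => ?_
  rw [opeProd_ncoeff, Nat.cast_succ, add_sub_cancel_right, discrepancy_YI, map_sum,
    Finset.sum_apply]
  refine Finset.sum_congr rfl fun R _ => ?_
  rw [map_smul, Pi.smul_apply, opeProd_ncoeff, Nat.add_sub_cancel]
  congr 2
  ring

end SymplecticBosons

end

end BosonicVOA

/-! ### The operator product expansion -/

open BosonicVOA
theorem theorem3 {n : ℕ} (hn : 2 ≤ n) {V : Type*} [AddCommGroup V] [Module ℂ V]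
    (S : SymplecticBosons n V) (I J K L M : Finset (Fin n))
    (hK : K = I ∩ J) (hL : L = I \ K) (hM : M = J \ K) :
    (I ≠ J →
      (∀ p : ℕ, 1 ≤ p → p ≤ L.card + M.card →
        opeProd p (S.YI I) (S.YI J) =
          ∑ ab ∈ indexSet L M p, ∑ L' ∈ removed L ab.1, ∑ M' ∈ removed M ab.2,
            ((-1 : ℂ) ^ ((ab.2 : ℤ) - p) * ((ab.1 + ab.2 - 1).choose (p - 1) : ℂ)) •
              opeProd ((p : ℤ) - ab.1 - ab.2) (S.YI (K ∪ L')) (S.YI (K ∪ M'))) ∧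
      (∀ p : ℕ, L.card + M.card + 1 ≤ p → opeProd p (S.YI I) (S.YI J) = 0) ∧
      HasOPE (S.YI I) (S.YI J) (L.card + M.card) (fun p =>
        ∑ ab ∈ indexSet L M p, ∑ L' ∈ removed L ab.1, ∑ M' ∈ removed M ab.2,
          ((-1 : ℂ) ^ ((ab.2 : ℤ) - p) / ((ab.1 + ab.2 - p).factorial : ℂ) *
              ((ab.1 + ab.2 - 1).choose (p - 1) : ℂ)) •
            opeProd 0 (fieldDeriv^[ab.1 + ab.2 - p] (S.YI (K ∪ L'))) (S.YI (K ∪ M')))) ∧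
    (I = J →
      (∀ p : ℕ, 1 ≤ p → opeProd p (S.YI I) (S.YI I) = 0) ∧
      HasOPE (S.YI I) (S.YI I) 0 (fun _ => 0)) := by
  subst hK hL hM
  have hcard : (I \ (I ∩ J)).card + (J \ (I ∩ J)).card = (symmDiff I J).card := by
    rw [symmDiff, Finset.sup_eq_union, Finset.sdiff_inter_self_left, Finset.inter_comm,
      Finset.sdiff_inter_self_left, Finset.card_union_of_disjoint disjoint_sdiff_sdiff]
  rw [hcard]
  refine ⟨fun _ => ⟨fun p hp _ => S.opeProd_YI I J hp, fun p hp => S.opeProd_YI_eq_zero I J hp,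
    hasOPE_of_discrepancy_eq_zero (S.discrepancy_YI_eq_zero I J le_rfl) fun p hp _ => ?_⟩, ?_⟩
  · rw [S.opeProd_YI I J hp]
    refine Finset.sum_congr rfl fun ab hab => Finset.sum_congr rfl fun L' _ =>
      Finset.sum_congr rfl fun M' _ => ?_
    have hp' : p ≤ ab.1 + ab.2 := (Finset.mem_filter.1 hab).2
    -- Here `p - a - b = -(a + b - p)`; the factorial from integrating by parts cancels the
    -- denominator.
    rw [opeProd_zero_iterate_fieldDeriv, smul_smul, Nat.cast_sub hp', neg_sub, Nat.cast_add,
      ← sub_sub]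
    congr 1
    field_simp [Nat.factorial_ne_zero]
  · rintro rfl
    exact ⟨fun p hp => S.opeProd_YI_eq_zero I I (by simpa using hp),
      hasOPE_of_discrepancy_eq_zero (S.discrepancy_YI_eq_zero I I (by simp)) fun p _ _ => by omega⟩
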